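/- Let $\mathbb S^2\subset\mathbb R^3$ be the unit sphere with surface measure $ds$, $m_a$ its area, $m_l$ curve length and $\mathrm d(x,y)=\arccos\langle x,y\rangle$. For distinct points $x_1,\dots,x_N\in\mathbb S^2$ let $$V_i=\{x\in\mathbb S^2:\ \mathrm d(x,x_i)<\mathrm d(x,x_j)\ \text{for all } j\ne i\},\qquad \Gamma_{ij}=\overline{V_i}\cap\overline{V_j},$$ $$\Lambda_i=\{j\ne i:\ m_l(\Gamma_{ij})>0\},\qquad h=\max_i\sup_{x\in V_i}\mathrm d(x_i,x).$$ The Voronoi decomposition is called almost uniform with constants $C_0,C_1>0$ if $\frac1{C_0}h\le m_l(\Gamma_{ij})\le C_0h$ and $\frac1{C_1}h^2\le m_a(V_i)\le C_1h^2$ for all $i$ and all $j\in\Lambda_i$. Let $\mathcal T_h$ be a Delaunay triangulation with vertices $x_1,\dots,x_N$, i.e. a set of triples $\{i,j,k\}$ of distinct indices such that $\overline{V_i}\cap\overline{V_j}\cap\overline{V_k}\neq\emptyset$ for each triple, such that the radial projections onto $\mathbb S^2$ of the planar triangles with vertices $x_i,x_j,x_k$ cover $\mathbb S^2$, and such that any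 two of these geodesic triangles meet exactly in their common face (a vertex, an edge, or nothing, if they are different). Let $\mathbf S_h$ be the union of the planar triangles, $\mathcal P(z)=z/\|z\|$ the radial projection of $\mathbf S_h$ onto $\mathbb S^2$, and $$\widetilde U_h=\Big\{u\in C^0(\mathbb S^2):\ u=\bar u\circ\mathcal P^{-1},\ \bar u\in C^0(\mathbf S_h)\text{ affine on each planar triangle},\ \int_{\mathbb S^2}u\,ds=0\Big\}.$$ For $f\in L^2(\mathbb S^2)$ with $\int_{\mathbb S^2}f\,ds=0$, the finite volume solution is the function $u_h\in\widetilde U_h$ such that $$\sum_{i=1}^N v_h(x_i)\sum_{j\in\Lambda_i}-m_l(\Gamma_{ij})\frac{u_h(x_j)-u_h(x_i)}{\|x_j-x_i\|}=\int_{\mathbb S^2}f\,\sum_{i=1}^N v_h(x_i)\chi_{V_i}\,ds\qquad\text{for all }v_h\in\widetilde U_h .$$ **Proposition.** For all $C_0,C_1>0$ and every $h_0<1$ there is a constant $C>0$, depending only on $C_0$, $C_1$ and $h_0$, such that for every $N$, all distinct points $x_1,\dots,x_N\in\mathbb S^2$ whose Voronoi decomposition is almost uniform with constants $C_0,C_1$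 and has $h\le h_0$, every Delaunay triangulation with these vertices, every $f\in L^2(\mathbb S^2)$ with $\int_{\mathbb S^2}f\,ds=0$ and every finite volume solution $u_h\in\widetilde U_h$, $$\|u_h\|_{L^\infty(\mathbb S^2)}\le C\,|\ln h|^{1/2}\,\|f\|_{L^2(\mathbb S^2)} .$$ -/

import Mathlib

open MeasureTheory Set

namespace SphereFV

/-- Euclidean three-space. -/
abbrev E3 : Type := EuclideanSpace ℝ (Fin 3)

/-- The unit sphere in three-space. -/
abbrev S2 : Type := Metric.sphere (0 : E3) 1

/-- The surface area measure on the unit sphere (total mass `4 * π`). -/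
noncomputable def area : Measure S2 := (volume : Measure E3).toSphere

/-- Geodesic distance on the unit sphere. -/
noncomputable def geoDist (y z : S2) : ℝ := Real.arccos (inner ℝ (y : E3) (z : E3))

/-- Length of a subset of a curve on the sphere: one-dimensional Hausdorff measure. -/
noncomputable def len (s : Set S2) : ℝ := (Measure.hausdorffMeasure 1 s).toReal

section Grid

variable {N : ℕ} (x : Fin N → S2)

/-- The open Voronoi cell of the generator `x i`. -/
def cell (i : Fin N) : Set S2 := {y | ∀ j, j ≠ i → geoDist y (x i) < geoDist y (x j)}

/-- The Voronoi edge between the cells of `x i` and `x j`. -/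
def edge (i j : Fin N) : Set S2 := closure (cell x i) ∩ closure (cell x j)

open Classical in
/-- The neighbours of `i`: the indices `j ≠ i` whose Voronoi edge with `i` has positive length. -/
noncomputable def nbrs (i : Fin N) : Finset (Fin N) :=
  Finset.univ.filter fun j => j ≠ i ∧ 0 < len (edge x i j)

/-- The mesh size: the largest geodesic distance of a generator to a point of its own cell. -/
noncomputable def meshSize : ℝ := ⨆ i, sSup (geoDist (x i) '' cell x i)

/-- Almost uniformity of the Voronoi decomposition, with constants `C₀` and `C₁`. -/
structure AlmostUniform (C₀ C₁ : ℝ) : Prop where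
  edge_lower : ∀ i, ∀ j ∈ nbrs x i, 1 / C₀ * meshSize x ≤ len (edge x i j)
  edge_upper : ∀ i, ∀ j ∈ nbrs x i, len (edge x i j) ≤ C₀ * meshSize x
  cell_lower : ∀ i, 1 / C₁ * meshSize x ^ 2 ≤ area.real (cell x i)
  cell_upper : ∀ i, area.real (cell x i) ≤ C₁ * meshSize x ^ 2

/-- The planar simplex spanned by the generators with index in `t`. -/
def planarSimplex (t : Finset (Fin N)) : Set E3 :=
  convexHull ℝ ((fun i => (x i : E3)) '' (t : Set (Fin N)))

/-- The radial projection to the sphere of the planar simplex spanned by `t`. -/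
def geoSimplex (t : Finset (Fin N)) : Set S2 :=
  {y | ∃ r : ℝ, 0 < r ∧ r • (y : E3) ∈ planarSimplex x t}

/-- `T` is a spherical Delaunay triangulation with the generators as vertices: it consists of
triples whose closed Voronoi cells have a common point (the centre of an empty circumscribed cap),
its geodesic triangles cover the sphere, and two of them meet exactly in their common face. -/
structure IsDelaunay (T : Finset (Finset (Fin N))) : Prop where
  card_eq : ∀ t ∈ T, t.card = 3
  dual : ∀ t ∈ T, (⋂ i ∈ t, closure (cell x i)).Nonempty
  cover : ∀ y : S2, ∃ t ∈ T, y ∈ geoSimplex x t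
  conforming : ∀ s ∈ T, ∀ t ∈ T, geoSimplex x s ∩ geoSimplex x t = geoSimplex x (s ∩ t)

/-- The polyhedral surface inscribed in the sphere, made of the planar triangles of `T`. -/
def polyhedron (T : Finset (Finset (Fin N))) : Set E3 := ⋃ t ∈ T, planarSimplex x t

/-- The continuous piecewise affine functions on the polyhedral surface. -/
def PlanarP1 (T : Finset (Finset (Fin N))) (w : E3 → ℝ) : Prop :=
  ContinuousOn w (polyhedron x T) ∧
    ∀ t ∈ T, ∃ A : E3 →ᵃ[ℝ] ℝ, EqOn w A (planarSimplex x t)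

/-- The lifted finite element functions on the sphere: `u = w ∘ P⁻¹` with `w` piecewise affine on
the polyhedral surface and `P` the radial projection `z ↦ z / ‖z‖`. -/
def LiftedP1 (T : Finset (Finset (Fin N))) (u : S2 → ℝ) : Prop :=
  Continuous u ∧ ∃ w : E3 → ℝ, PlanarP1 x T w ∧
    ∀ z ∈ polyhedron x T, ∀ y : S2, (y : E3) = ‖z‖⁻¹ • z → u y = w z

/-- The zero-averaged lifted finite element space. -/
def trialSpace (T : Finset (Finset (Fin N))) : Set (S2 → ℝ) :=
  {u | LiftedP1 x T u ∧ ∫ y, u y ∂area = 0}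

/-- The transference operator to functions that are constant on each Voronoi cell. -/
noncomputable def transfer (v : S2 → ℝ) (y : S2) : ℝ :=
  ∑ i, v (x i) * (cell x i).indicator (fun _ => (1 : ℝ)) y

/-- The central difference approximation of the flux across a Voronoi edge. -/
noncomputable def flux (u : S2 → ℝ) (i j : Fin N) : ℝ :=
  -(len (edge x i j) * ((u (x j) - u (x i)) / ‖(x j : E3) - (x i : E3)‖))

/-- The discrete total flux bilinear form, evaluated at `u` and `transfer x v`. -/
noncomputable def fluxForm (u v : S2 → ℝ) : ℝ :=
  ∑ i, v (x i) * ∑ j ∈ nbrs x i, flux x u i j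

/-- `u` solves the finite volume problem with source `f`. -/
def IsFVSolution (T : Finset (Finset (Fin N))) (f u : S2 → ℝ) : Prop :=
  u ∈ trialSpace x T ∧
    ∀ v ∈ trialSpace x T, fluxForm x u v = ∫ y, f y * transfer x v y ∂area

end Grid

end SphereFV

open SphereFV

namespace SphereFV

/-! The proof combines an energy estimate with a discrete Sobolev inequality that loses only a
logarithm; both rest on one potential estimate, `volume_mul_abs_sub_le`.

Join `x i` and `x j` by straight segments to a common random point `z` of a fixed-size ball in
space. Along a generic segment the oscillation of a grid function is at most the sum of the jumps of
the visited cells (`abs_sub_le_sum_jump`). A segment from `x i` visits the cone over cell `k` only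
if `z` lies in a slab of width comparable to `kern x i k` (`abs_inner_le_of_segment_mem`). Averaging
over `z` bounds `|u i - u j|` by the potentials of the jumps at `i` and `j`.

Area bounds and packing give `∑ kern ≲ 1/h` and `∑ kern² ≲ |log h|`. The first sum and Schur's test
yield a Poincaré inequality uniform in the mesh; the second and Cauchy–Schwarz bound oscillations by
`|log h|^(1/2)` times the root of the Dirichlet energy. Testing the scheme with its own solution,
the Poincaré inequality and the zero mean of `f` bound that energy by the squared L² norm of `f`
(`dirichlet_le_integral_sq`). Finally, a zero-averaged finite element function is bounded by the
oscillation of its vertex values. -/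

instance : IsFiniteMeasure area := by unfold area; infer_instance

instance : area.IsOpenPosMeasure := by unfold area; infer_instance

/-! ### Volumes of slabs, areas of caps and great circles -/

/-- The volume of a box with respect to an orthonormal basis. -/
lemma volume_box_le (b : OrthonormalBasis (Fin 3) ℝ E3) (c : Fin 3 → ℝ) :
    volume {v : E3 | ∀ i, |inner ℝ (b i) v| ≤ c i} ≤ ∏ i, ENNReal.ofReal (2 * c i) := by
  have h1 := (EuclideanSpace.volume_preserving_symm_measurableEquiv_toLp (Fin 3)).comp
    b.measurePreserving_repr
  have h2 : {v : E3 | ∀ i, |inner ℝ (b i) v| ≤ c i} =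
      ((MeasurableEquiv.toLp 2 (Fin 3 → ℝ)).symm ∘ b.repr) ⁻¹' Icc (fun i => -c i) c := by
    ext v
    simp only [mem_ofPred_eq, mem_preimage, Function.comp, mem_Icc, Pi.le_def, ← forall_and]
    refine forall_congr' fun i => ?_
    rw [abs_le, ← b.repr_apply_apply]
    rfl
  rw [h2, h1.measure_preimage measurableSet_Icc.nullMeasurableSet, Real.volume_Icc_pi]
  refine le_of_eq (Finset.prod_congr rfl fun i _ => ?_)
  congr 1; ring

/-- Every unit vector is the first vector of an orthonormal basis. -/
lemma exists_orthonormalBasis_zero (ν : E3) (hν : ‖ν‖ = 1) :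
    ∃ b : OrthonormalBasis (Fin 3) ℝ E3, b 0 = ν := by
  have hv : Orthonormal ℝ (({0} : Set (Fin 3)).domRestrict (fun _ => ν)) := by
    constructor
    · intro i; simpa using hν
    · intro i j hij
      exact absurd (Subsingleton.elim i j) hij
  obtain ⟨b, hb⟩ := hv.exists_orthonormalBasis_extension_of_card_eq (by simp)
  exact ⟨b, hb 0 rfl⟩

/-- Any two vectors of three-space have a common unit normal. -/
lemma exists_unit_normal (a b : E3) :
    ∃ ν : E3, ‖ν‖ = 1 ∧ inner ℝ ν a = 0 ∧ inner ℝ ν b = 0 := by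
  have hne : (Submodule.span ℝ ({a, b} : Set E3))ᗮ ≠ ⊥ := by
    intro h
    have h1 := Submodule.finrank_add_finrank_orthogonal (Submodule.span ℝ ({a, b} : Set E3))
    rw [h, finrank_bot] at h1
    have h2 : Module.finrank ℝ (Submodule.span ℝ ({a, b} : Set E3)) ≤ 2 :=
      (finrank_span_le_card _).trans (by
        rw [Set.toFinset_insert, Set.toFinset_singleton]; exact Finset.card_le_two)
    have h3 : Module.finrank ℝ E3 = 3 := by simp
    omega
  obtain ⟨v, hv, hv0⟩ := Submodule.exists_mem_ne_zero_of_ne_bot hne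
  have hn : ‖v‖ ≠ 0 := norm_ne_zero_iff.2 hv0
  rw [Submodule.mem_orthogonal'] at hv
  refine ⟨‖v‖⁻¹ • v, by rw [norm_smul, norm_inv, norm_norm, inv_mul_cancel₀ hn], ?_, ?_⟩
  · rw [real_inner_smul_left, hv a (Submodule.subset_span (by simp)), mul_zero]
  · rw [real_inner_smul_left, hv b (Submodule.subset_span (by simp)), mul_zero]

lemma abs_inner_le_of_norm_le {b v : E3} (hb : ‖b‖ = 1) {r : ℝ} (hv : ‖v‖ ≤ r) :
    |inner ℝ b v| ≤ r :=
  (abs_real_inner_le_norm b v).trans (by rw [hb, one_mul]; exact hv)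

/-- The part of the unit ball in a slab. -/
lemma volume_slab_le (ν : E3) (hν : ‖ν‖ = 1) {ε : ℝ} (hε : 0 ≤ ε) :
    volume {z : E3 | ‖z‖ ≤ 1 ∧ |inner ℝ ν z| ≤ ε} ≤ ENNReal.ofReal (8 * ε) := by
  obtain ⟨b, rfl⟩ := exists_orthonormalBasis_zero ν hν
  refine (measure_mono (t := {v : E3 | ∀ i, |inner ℝ (b i) v| ≤ ![ε, 1, 1] i}) ?_).trans
    ((volume_box_le b _).trans (le_of_eq ?_))
  · rintro z ⟨h1, h2⟩ i
    fin_cases i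
    · exact h2
    · exact abs_inner_le_of_norm_le (b.norm_eq_one 1) h1
    · exact abs_inner_le_of_norm_le (b.norm_eq_one 2) h1
  · rw [Fin.prod_univ_three, ← ENNReal.ofReal_mul (by simpa), ← ENNReal.ofReal_mul (by simpa)]
    congr 1; simp; ring

lemma volume_orthogonal_eq_zero {n : E3} (hn : n ≠ 0) : volume {z : E3 | inner ℝ n z = 0} = 0 := by
  have : {z : E3 | inner ℝ n z = 0} = ((Submodule.span ℝ {n})ᗮ : Submodule ℝ E3) := by
    ext z; simp [Submodule.mem_orthogonal_singleton_iff_inner_right]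
  rw [this]
  refine Measure.addHaar_submodule _ _ fun h => ?_
  have : n ∈ (Submodule.span ℝ {n})ᗮ := by rw [h]; trivial
  rw [Submodule.mem_orthogonal_singleton_iff_inner_right, inner_self_eq_zero] at this
  exact hn this

/-- `toSphere` is three times the volume of the truncated cone over a set, so areas reduce to
volumes. -/
lemma area_le_of_cone_subset {s : Set S2} (hs : MeasurableSet s) {t : Set E3}
    (h : ∀ y ∈ s, ∀ r ∈ Ioo (0 : ℝ) 1, r • (y : E3) ∈ t) : area s ≤ 3 * volume t := by
  rw [area, Measure.toSphere_apply' _ hs]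
  simp only [finrank_euclideanSpace, Fintype.card_fin, Nat.cast_ofNat]
  gcongr
  rintro _ ⟨r, hr, _, ⟨y, hy, rfl⟩, rfl⟩
  exact h y hy r hr

lemma area_greatCircle_eq_zero {n : E3} (hn : n ≠ 0) :
    area {y : S2 | inner ℝ n (y : E3) = 0} = 0 := by
  have := area_le_of_cone_subset (s := {y : S2 | inner ℝ n (y : E3) = 0})
    (t := {z : E3 | inner ℝ n z = 0})
    (IsClosed.measurableSet (isClosed_eq (by fun_prop) (by fun_prop))) (by
      intro y hy r _
      simp only [mem_ofPred_eq] at hy ⊢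
      rw [real_inner_smul_right, hy, mul_zero])
  rw [volume_orthogonal_eq_zero hn, mul_zero] at this
  exact le_antisymm this zero_le

/-- The area of a spherical cap is at most quadratic in its radius. -/
lemma area_ball_le (p : S2) {r : ℝ} (hr : 0 ≤ r) :
    area {y : S2 | ‖(y : E3) - p‖ ≤ r} ≤ ENNReal.ofReal (24 * r ^ 2) := by
  obtain ⟨b, hb⟩ := exists_orthonormalBasis_zero (p : E3) (by simp)
  refine (area_le_of_cone_subset (t := {v : E3 | ∀ i, |inner ℝ (b i) v| ≤ ![1, r, r] i})
    (IsClosed.measurableSet (isClosed_le (by fun_prop) (by fun_prop))) ?_).trans ?_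
  · intro y hy s hs i
    -- The basis starts with `p`, so the two other coordinates do not see `p` and only measure `s •
    -- (y - p)`.
    have key : ∀ j, j ≠ 0 → |inner ℝ (b j) (s • (y : E3))| ≤ r := by
      intro j hj
      have h0 : inner ℝ (b j) (p : E3) = 0 := by rw [← hb]; exact b.inner_eq_zero hj
      have : inner ℝ (b j) (s • (y : E3)) = s * inner ℝ (b j) ((y : E3) - p) := by
        rw [real_inner_smul_right, inner_sub_right, h0, sub_zero]
      rw [this, abs_mul, abs_of_pos hs.1]
      have h1 := abs_inner_le_of_norm_le (b.norm_eq_one j) hy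
      nlinarith [hs.1, hs.2, abs_nonneg (inner ℝ (b j) ((y : E3) - p))]
    fin_cases i
    · refine abs_inner_le_of_norm_le (b.norm_eq_one 0) ?_
      rw [norm_smul, norm_eq_of_mem_sphere, mul_one, Real.norm_eq_abs, abs_of_pos hs.1]
      exact hs.2.le
    · exact key 1 (by decide)
    · exact key 2 (by decide)
  · refine (mul_le_mul_right (volume_box_le b _) 3).trans (le_of_eq ?_)
    rw [Fin.prod_univ_three, ← ENNReal.ofReal_mul (by simp), ← ENNReal.ofReal_mul (by simpa),
      show (3 : ENNReal) = ENNReal.ofReal 3 by simp, ← ENNReal.ofReal_mul (by simp)]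
    congr 1; simp; ring

lemma area_real_ball_le (p : S2) {r : ℝ} (hr : 0 ≤ r) :
    area.real {y : S2 | ‖(y : E3) - p‖ ≤ r} ≤ 24 * r ^ 2 :=
  ENNReal.toReal_le_of_le_ofReal (by positivity) (area_ball_le p hr)

lemma norm_S2 (y : S2) : ‖(y : E3)‖ = 1 := norm_eq_of_mem_sphere y

lemma inner_S2_mem (y z : S2) : inner ℝ (y : E3) (z : E3) ∈ Icc (-1 : ℝ) 1 := by
  have := abs_real_inner_le_norm (y : E3) (z : E3)
  rw [norm_S2, norm_S2, one_mul, abs_le] at this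
  exact this

lemma inner_S2_lt_one {y z : S2} (h : y ≠ z) : inner ℝ (y : E3) (z : E3) < 1 :=
  (inner_lt_one_iff_real_of_norm_eq_one (norm_S2 y) (norm_S2 z)).2 fun e => h (Subtype.ext e)

/-- The chordal distance is at most the geodesic distance. -/
lemma norm_sub_le_geoDist (y z : S2) : ‖(y : E3) - z‖ ≤ geoDist y z := by
  have h := inner_S2_mem y z
  have h1 : Real.cos (geoDist y z) = inner ℝ (y : E3) (z : E3) := Real.cos_arccos h.1 h.2
  have h2 := Real.one_sub_sq_div_two_le_cos (x := geoDist y z)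
  have h3 : ‖(y : E3) - z‖ ^ 2 = 2 - 2 * inner ℝ (y : E3) (z : E3) := by
    rw [norm_sub_sq_real, norm_S2, norm_S2]; ring
  refine abs_le_of_sq_le_sq' ?_ (Real.arccos_nonneg _) |>.2
  change _ ≤ geoDist y z ^ 2
  rw [h3]; linarith

/-! ### Voronoi cells and the cones over them -/

section Grid

variable {N : ℕ} (x : Fin N → S2)

/-- The points at which no generator has a larger inner product than `x k`: the closed cone over
the Voronoi cell of `x k`. -/
def closedCone (k : Fin N) : Set E3 := {w | ∀ j, inner ℝ w (x j : E3) ≤ inner ℝ w (x k : E3)}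

variable {x}

/-- Since `arccos` is strictly decreasing, cells are cut out by linear inequalities, which also make
sense off the sphere. -/
lemma mem_cell_iff {i : Fin N} {y : S2} :
    y ∈ cell x i ↔ ∀ j, j ≠ i → inner ℝ (y : E3) (x j : E3) < inner ℝ (y : E3) (x i : E3) := by
  refine forall_congr' fun j => imp_congr_right fun _ => ?_
  exact Real.strictAntiOn_arccos.lt_iff_gt (inner_S2_mem _ _) (inner_S2_mem _ _)

lemma isOpen_cell (i : Fin N) : IsOpen (cell x i) := by
  have : cell x i = ⋂ j, ⋂ _ : j ≠ i,
      {y : S2 | inner ℝ (y : E3) (x j : E3) < inner ℝ (y : E3) (x i : E3)} := by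
    ext y; simp [mem_cell_iff]
  rw [this]
  exact isOpen_iInter_of_finite fun j => isOpen_iInter_of_finite fun _ =>
    isOpen_lt (by fun_prop) (by fun_prop)

lemma measurableSet_cell (i : Fin N) : MeasurableSet (cell x i) := (isOpen_cell i).measurableSet

lemma generator_mem_cell (hx : Function.Injective x) (i : Fin N) : x i ∈ cell x i := by
  rw [mem_cell_iff]
  intro j hj
  rw [real_inner_self_eq_norm_sq, norm_S2, one_pow]
  exact inner_S2_lt_one fun e => hj (hx e).symm

lemma cell_disjoint {i j : Fin N} (hij : i ≠ j) : Disjoint (cell x i) (cell x j) := by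
  rw [Set.disjoint_left]
  intro y hi hj
  rw [mem_cell_iff] at hi hj
  exact lt_asymm (hi j hij.symm) (hj i hij)

lemma isClosed_closedCone (k : Fin N) : IsClosed (closedCone x k) := by
  have : closedCone x k = ⋂ j, {w : E3 | inner ℝ w (x j : E3) ≤ inner ℝ w (x k : E3)} := by
    ext y; simp [closedCone]
  rw [this]
  exact isClosed_iInter fun j => isClosed_le (by fun_prop) (by fun_prop)

lemma smul_mem_closedCone {k : Fin N} {w : E3} (hw : w ∈ closedCone x k) {r : ℝ} (hr : 0 ≤ r) :
    r • w ∈ closedCone x k := by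
  intro j
  rw [real_inner_smul_left, real_inner_smul_left]
  exact mul_le_mul_of_nonneg_left (hw j) hr

lemma exists_mem_closedCone [Nonempty (Fin N)] (w : E3) : ∃ k, w ∈ closedCone x k := by
  obtain ⟨k, hk⟩ := Finite.exists_max fun j => inner ℝ w (x j : E3)
  exact ⟨k, hk⟩

lemma cell_subset_closedCone {i : Fin N} {y : S2} (hy : y ∈ cell x i) :
    (y : E3) ∈ closedCone x i := by
  intro j
  rcases eq_or_ne j i with rfl | hj
  · exact le_rfl
  · exact (mem_cell_iff.1 hy j hj).le

lemma mem_closedCone_of_mem_closure {i : Fin N} {y : S2} (hy : y ∈ closure (cell x i)) :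
    (y : E3) ∈ closedCone x i := by
  have : IsClosed {y : S2 | (y : E3) ∈ closedCone x i} :=
    (isClosed_closedCone i).preimage continuous_subtype_val
  exact closure_minimal (fun y hy => cell_subset_closedCone hy) this hy

/-- Adding `ε • x k` makes all weak inequalities strict, because `⟪x k, x k⟫ = 1 > ⟪x k, x j⟫`;
normalise and let `ε` tend to zero. The antipode of `x k`, where normalisation may fail, is treated
apart. -/
lemma mem_closure_cell (hx : Function.Injective x) {k : Fin N} {y : S2}
    (hy : (y : E3) ∈ closedCone x k) : y ∈ closure (cell x k) := by
  by_cases hyk : y = x k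
  · rw [hyk]; exact subset_closure (generator_mem_cell hx k)
  by_cases hyk' : (y : E3) = -(x k : E3)
  · by_cases hj : ∃ j, j ≠ k
    · obtain ⟨j, hj⟩ := hj
      have h1 := hy j
      rw [hyk', inner_neg_left, inner_neg_left, real_inner_self_eq_norm_sq, norm_S2, one_pow] at h1
      have := inner_S2_lt_one (y := x k) (z := x j) fun e => hj (hx e).symm
      linarith
    · push Not at hj
      refine subset_closure ?_
      rw [mem_cell_iff]
      exact fun j h => absurd (hj j) h
  have hne : ∀ ε : ℝ, 0 ≤ ε → (y : E3) + ε • (x k : E3) ≠ 0 := by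
    intro ε hε h
    have h1 : (y : E3) = -(ε • (x k : E3)) := eq_neg_of_add_eq_zero_left h
    have h2 : ε = 1 := by
      have := congrArg norm h1
      rw [norm_neg, norm_smul, norm_S2, norm_S2, mul_one, Real.norm_eq_abs, abs_of_nonneg hε] at this
      exact this.symm
    rw [h2, one_smul] at h1
    exact hyk' h1
  let g : ℝ → S2 := fun ε => if h : 0 ≤ ε then
    ⟨‖(y : E3) + ε • (x k : E3)‖⁻¹ • ((y : E3) + ε • (x k : E3)), by
      rw [mem_sphere_zero_iff_norm, norm_smul, norm_inv, norm_norm,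
        inv_mul_cancel₀ (norm_ne_zero_iff.2 (hne ε h))]⟩ else y
  have hg : ∀ ε : ℝ, 0 ≤ ε →
      (g ε : E3) = ‖(y : E3) + ε • (x k : E3)‖⁻¹ • ((y : E3) + ε • (x k : E3)) := by
    intro ε h
    simp only [g, dif_pos h]
  have hlim : Filter.Tendsto g (nhdsWithin 0 (Ioi 0)) (nhds y) := by
    rw [tendsto_subtype_rng]
    have hc : ContinuousAt (fun ε : ℝ =>
        ‖(y : E3) + ε • (x k : E3)‖⁻¹ • ((y : E3) + ε • (x k : E3))) 0 := by
      have hc0 : ContinuousAt (fun ε : ℝ => (y : E3) + ε • (x k : E3)) 0 := by fun_prop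
      refine (hc0.norm.inv₀ ?_).smul hc0
      exact norm_ne_zero_iff.2 (hne 0 le_rfl)
    have h1 : Filter.Tendsto (fun ε : ℝ =>
        ‖(y : E3) + ε • (x k : E3)‖⁻¹ • ((y : E3) + ε • (x k : E3))) (nhdsWithin 0 (Ioi 0))
        (nhds (y : E3)) := by
      have := hc.tendsto.mono_left (nhdsWithin_le_nhds (s := Ioi (0 : ℝ)))
      simpa [norm_S2] using this
    refine h1.congr' ?_
    filter_upwards [self_mem_nhdsWithin] with ε hε
    exact (hg ε (le_of_lt hε)).symm
  refine mem_closure_of_tendsto hlim ?_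
  filter_upwards [self_mem_nhdsWithin] with ε hε
  have hε : 0 < ε := hε
  rw [mem_cell_iff]
  intro j hj
  rw [hg ε hε.le, real_inner_smul_left, real_inner_smul_left]
  refine mul_lt_mul_of_pos_left ?_ (inv_pos.2 (norm_pos_iff.2 (hne ε hε.le)))
  rw [inner_add_left, inner_add_left, real_inner_smul_left, real_inner_smul_left]
  have h1 := hy j
  have h2 := inner_S2_lt_one (y := x k) (z := x j) fun e => hj (hx e).symm
  rw [real_inner_self_eq_norm_sq, norm_S2]
  nlinarith

lemma norm_sub_le_meshSize_of_mem_cell {i : Fin N} {y : S2} (hy : y ∈ cell x i) :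
    ‖(x i : E3) - y‖ ≤ meshSize x := by
  refine (norm_sub_le_geoDist _ _).trans ?_
  have h1 : geoDist (x i) y ≤ sSup (geoDist (x i) '' cell x i) :=
    le_csSup ⟨Real.pi, by rintro _ ⟨z, -, rfl⟩; exact Real.arccos_le_pi _⟩ ⟨y, hy, rfl⟩
  exact h1.trans (le_ciSup (f := fun i => sSup (geoDist (x i) '' cell x i))
    (Set.finite_range _).bddAbove i)

lemma norm_sub_le_meshSize_of_mem_closure {i : Fin N} {y : S2} (hy : y ∈ closure (cell x i)) :
    ‖(x i : E3) - y‖ ≤ meshSize x := by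
  have : IsClosed {y : S2 | ‖(x i : E3) - y‖ ≤ meshSize x} :=
    isClosed_le (by fun_prop) (by fun_prop)
  exact closure_minimal (fun y hy => norm_sub_le_meshSize_of_mem_cell hy) this hy

/-- Homogeneous form of the mesh size bound, used for points of segments inside the ball. -/
lemma norm_sub_le_of_mem_closedCone (hx : Function.Injective x) {k : Fin N} {w : E3}
    (hw : w ∈ closedCone x k) : ‖w - ‖w‖ • (x k : E3)‖ ≤ meshSize x * ‖w‖ := by
  by_cases h0 : w = 0
  · simp [h0]
  have hn : 0 < ‖w‖ := norm_pos_iff.2 h0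
  let y : S2 := ⟨‖w‖⁻¹ • w, by
    rw [mem_sphere_zero_iff_norm, norm_smul, norm_inv, norm_norm, inv_mul_cancel₀ hn.ne']⟩
  have hy : (y : E3) = ‖w‖⁻¹ • w := rfl
  have h1 := norm_sub_le_meshSize_of_mem_closure (mem_closure_cell hx (y := y)
    (smul_mem_closedCone hw (inv_nonneg.2 hn.le)))
  have h2 : w - ‖w‖ • (x k : E3) = -(‖w‖ • ((x k : E3) - y)) := by
    rw [hy, smul_sub, smul_smul, mul_inv_cancel₀ hn.ne', one_smul, neg_sub]
  rw [h2, norm_neg, norm_smul, norm_norm, mul_comm]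
  exact mul_le_mul_of_nonneg_right h1 hn.le

lemma edge_comm (i j : Fin N) : edge x i j = edge x j i := Set.inter_comm _ _

lemma mem_nbrs {i j : Fin N} : j ∈ nbrs x i ↔ j ≠ i ∧ 0 < len (edge x i j) := by
  simp [nbrs]

lemma mem_nbrs_comm {i j : Fin N} : j ∈ nbrs x i ↔ i ∈ nbrs x j := by
  rw [mem_nbrs, mem_nbrs, edge_comm, ne_comm]

lemma norm_sub_le_of_mem_nbrs {i j : Fin N} (h : j ∈ nbrs x i) :
    ‖(x j : E3) - x i‖ ≤ 2 * meshSize x := by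
  have hne : (edge x i j).Nonempty := by
    rw [nonempty_iff_ne_empty]
    intro h0
    have := (mem_nbrs.1 h).2
    simp [h0, len] at this
  obtain ⟨y, hi, hj⟩ := hne
  have h1 := norm_sub_le_meshSize_of_mem_closure hi
  have h2 := norm_sub_le_meshSize_of_mem_closure hj
  calc ‖(x j : E3) - x i‖ = ‖((x j : E3) - y) - ((x i : E3) - y)‖ := by congr 1; abel
    _ ≤ _ := norm_sub_le _ _
    _ ≤ _ := by linarith

/-- The open cells cover the sphere up to a null set. -/
lemma ae_exists_mem_cell [Nonempty (Fin N)] (hx : Function.Injective x) :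
    ∀ᵐ y ∂area, ∃ i, y ∈ cell x i := by
  have h : ∀ᵐ y : S2 ∂area, ∀ i j, i ≠ j → inner ℝ ((x i : E3) - x j) (y : E3) ≠ 0 := by
    rw [ae_all_iff]; intro i
    rw [ae_all_iff]; intro j
    by_cases hij : i = j
    · simp [hij]
    · have h0 := area_greatCircle_eq_zero (n := (x i : E3) - x j)
        (sub_ne_zero.2 fun e => hij (hx (Subtype.ext e)))
      filter_upwards [measure_eq_zero_iff_ae_notMem.1 h0] with y hy _
      exact hy
  filter_upwards [h] with y hy
  obtain ⟨k, hk⟩ := exists_mem_closedCone (x := x) (y : E3)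
  refine ⟨k, mem_cell_iff.2 fun j hj => lt_of_le_of_ne (hk j) fun e => hy j k hj ?_⟩
  rw [inner_sub_left, real_inner_comm, e, real_inner_comm, sub_self]

end Grid

/-! ### Edges of positive length and generic segments -/

/-- Great circles have finite length. -/
lemma hausdorffMeasure_greatCircle_lt_top {n : E3} (hn : n ≠ 0) :
    Measure.hausdorffMeasure 1 {y : S2 | inner ℝ n (y : E3) = 0} < ⊤ := by
  have hn' : ‖n‖ ≠ 0 := norm_ne_zero_iff.2 hn
  obtain ⟨b, hb⟩ := exists_orthonormalBasis_zero (‖n‖⁻¹ • n)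
    (by rw [norm_smul, norm_inv, norm_norm, inv_mul_cancel₀ hn'])
  have h12 : inner ℝ (b 1) (b 2) = 0 := b.inner_eq_zero (by decide)
  let f : ℝ → S2 := fun θ => ⟨Real.cos θ • b 1 + Real.sin θ • b 2, by
    have h : ‖Real.cos θ • b 1 + Real.sin θ • b 2‖ ^ 2 = 1 := by
      rw [norm_add_sq_real, norm_smul, norm_smul, b.norm_eq_one, b.norm_eq_one,
        real_inner_smul_left, real_inner_smul_right, h12, mul_one, mul_one, Real.norm_eq_abs,
        Real.norm_eq_abs, sq_abs, sq_abs]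
      linarith [Real.cos_sq_add_sin_sq θ]
    rw [mem_sphere_zero_iff_norm]
    exact (pow_eq_one_iff_of_nonneg (norm_nonneg _) two_ne_zero).1 h⟩
  have hf : LipschitzWith 2 f := by
    refine LipschitzWith.of_dist_le_mul fun θ φ => ?_
    rw [Subtype.dist_eq, dist_eq_norm, Real.dist_eq]
    have h1 : (f θ : E3) - f φ =
        (Real.cos θ - Real.cos φ) • b 1 + (Real.sin θ - Real.sin φ) • b 2 := by
      simp only [f]; module
    have hc : |Real.cos θ - Real.cos φ| ≤ |θ - φ| := Real.abs_cos_sub_cos_le θ φ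
    have hs : |Real.sin θ - Real.sin φ| ≤ |θ - φ| := Real.abs_sin_sub_sin_le θ φ
    rw [h1]
    refine (norm_add_le _ _).trans ?_
    rw [norm_smul, norm_smul, b.norm_eq_one, b.norm_eq_one, mul_one, mul_one, Real.norm_eq_abs,
      Real.norm_eq_abs, NNReal.coe_ofNat]
    linarith
  have hsub : {y : S2 | inner ℝ n (y : E3) = 0} ⊆ f '' Icc (-Real.pi) Real.pi := by
    intro y hy
    have hy0 : inner ℝ (b 0) (y : E3) = 0 := by
      rw [hb, real_inner_smul_left, show inner ℝ n (y : E3) = 0 from hy, mul_zero]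
    have hsum := b.sum_repr' (y : E3)
    rw [Fin.sum_univ_three, hy0, zero_smul, zero_add] at hsum
    set α := inner ℝ (b 1) (y : E3)
    set β := inner ℝ (b 2) (y : E3)
    have hαβ : α ^ 2 + β ^ 2 = 1 := by
      have h := congrArg (fun v : E3 => ‖v‖ ^ 2) hsum
      simp only [norm_S2] at h
      rw [norm_add_sq_real, norm_smul, norm_smul, b.norm_eq_one, b.norm_eq_one,
        real_inner_smul_left, real_inner_smul_right, h12, mul_one, mul_one, Real.norm_eq_abs,
        Real.norm_eq_abs, sq_abs, sq_abs] at h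
      linarith
    have hz : ‖(⟨α, β⟩ : ℂ)‖ = 1 := by
      rw [Complex.norm_eq_sqrt_sq_add_sq, hαβ, Real.sqrt_one]
    refine ⟨Complex.arg ⟨α, β⟩, ⟨(Complex.neg_pi_lt_arg _).le, Complex.arg_le_pi _⟩, ?_⟩
    apply Subtype.ext
    have h1 := Complex.norm_mul_cos_arg (⟨α, β⟩ : ℂ)
    have h2 := Complex.norm_mul_sin_arg (⟨α, β⟩ : ℂ)
    rw [hz, one_mul] at h1 h2
    simp only [f, h1, h2]
    exact hsum
  refine (measure_mono hsub).trans_lt ((hf.hausdorffMeasure_image_le zero_le_one _).trans_lt ?_)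
  rw [hausdorffMeasure_real, Real.volume_Icc]
  exact ENNReal.mul_lt_top (by simp) ENNReal.ofReal_lt_top

section Grid

variable {N : ℕ} {x : Fin N → S2}

/-- An edge lies on a bisecting great circle. Finiteness is needed because `toReal` in `len` would
turn an infinite length into zero. -/
lemma hausdorffMeasure_edge_lt_top (hx : Function.Injective x) {k l : Fin N} (hkl : k ≠ l) :
    Measure.hausdorffMeasure 1 (edge x k l) < ⊤ := by
  refine (measure_mono ?_).trans_lt (hausdorffMeasure_greatCircle_lt_top
    (n := (x k : E3) - x l) (sub_ne_zero.2 fun e => hkl (hx (Subtype.ext e))))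
  rintro y ⟨hk, hl⟩
  have h1 := mem_closedCone_of_mem_closure hk l
  have h2 := mem_closedCone_of_mem_closure hl k
  change inner ℝ ((x k : E3) - x l) (y : E3) = 0
  rw [inner_sub_left, real_inner_comm, real_inner_comm (y : E3)]
  linarith

/-- Two cells that meet at a point of no third cell share an edge of positive length. -/
lemma mem_nbrs_of_mem_closedCone (hx : Function.Injective x) {k l : Fin N} (hkl : k ≠ l) {p : E3}
    (hp : p ≠ 0) (hk : p ∈ closedCone x k) (hl : p ∈ closedCone x l)
    (hother : ∀ j, j ≠ k → j ≠ l → inner ℝ p (x j : E3) < inner ℝ p (x k : E3)) :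
    l ∈ nbrs x k := by
  -- Moving `p` along `q` stays in the bisecting plane, and the strict inequalities against third
  -- generators survive for small steps.
  obtain ⟨q, hq, hqp, hqkl⟩ := exists_unit_normal p ((x k : E3) - x l)
  rw [inner_sub_right, sub_eq_zero] at hqkl
  have hpkl : inner ℝ p (x k : E3) = inner ℝ p (x l : E3) := le_antisymm (hl k) (hk l)
  have hpn : 0 < ‖p‖ := norm_pos_iff.2 hp
  have hnorm : ∀ s : ℝ, p + s • q ≠ 0 := by
    intro s h0
    have := congrArg (fun v => inner ℝ v p) h0
    simp only [inner_add_left, real_inner_smul_left, hqp, mul_zero, add_zero, inner_zero_left] at this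
    exact hp (inner_self_eq_zero.1 this)
  have hev : ∀ᶠ s : ℝ in nhds 0, ∀ j, j ≠ k → j ≠ l →
      inner ℝ (p + s • q) (x j : E3) < inner ℝ (p + s • q) (x k : E3) := by
    rw [Filter.eventually_all]; intro j
    by_cases hjk : j = k
    · simp [hjk]
    by_cases hjl : j = l
    · simp [hjl]
    have h1 : ContinuousAt (fun s : ℝ => inner ℝ (p + s • q) (x j : E3)) 0 := by fun_prop
    have h2 : ContinuousAt (fun s : ℝ => inner ℝ (p + s • q) (x k : E3)) 0 := by fun_prop
    filter_upwards [h1.eventually_lt h2 (by simpa using hother j hjk hjl)] with s hs _ _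
    exact hs
  obtain ⟨δ, hδ, hball⟩ := Metric.eventually_nhds_iff.1 hev
  let γ : ℝ → S2 := fun s => ⟨‖p + s • q‖⁻¹ • (p + s • q), by
    rw [mem_sphere_zero_iff_norm, norm_smul, norm_inv, norm_norm,
      inv_mul_cancel₀ (norm_ne_zero_iff.2 (hnorm s))]⟩
  have hγ : ∀ s ∈ Icc 0 (δ / 2), γ s ∈ edge x k l := by
    intro s hs
    have hs' := hball (y := s) (by
      rw [Real.dist_eq, sub_zero, abs_of_nonneg hs.1]; linarith [hs.2])
    have heq : inner ℝ (p + s • q) (x k : E3) = inner ℝ (p + s • q) (x l : E3) := by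
      rw [inner_add_left, inner_add_left, real_inner_smul_left, real_inner_smul_left, hqkl, hpkl]
    have hck : p + s • q ∈ closedCone x k := by
      intro j
      by_cases hjk : j = k
      · rw [hjk]
      by_cases hjl : j = l
      · rw [hjl, heq]
      exact (hs' j hjk hjl).le
    have hcl : p + s • q ∈ closedCone x l := fun j => (hck j).trans heq.le
    exact ⟨mem_closure_cell hx (smul_mem_closedCone hck (inv_nonneg.2 (norm_nonneg _))),
      mem_closure_cell hx (smul_mem_closedCone hcl (inv_nonneg.2 (norm_nonneg _)))⟩
  -- This 1-Lipschitz function maps the arc `γ` onto an interval of positive length, so the edge has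
  -- positive length.
  let φ : S2 → ℝ := fun y => inner ℝ q (y : E3)
  have hφ : LipschitzWith 1 φ := by
    refine LipschitzWith.of_dist_le_mul fun y z => ?_
    rw [Real.dist_eq, Subtype.dist_eq, dist_eq_norm, NNReal.coe_one, one_mul]
    simp only [φ]
    rw [← inner_sub_right]
    exact abs_inner_le_of_norm_le hq le_rfl
  have hφγ : ∀ s, φ (γ s) = ‖p + s • q‖⁻¹ * s := by
    intro s
    simp only [φ, γ, real_inner_smul_right, inner_add_right, hqp, real_inner_self_eq_norm_sq, hq]
    ring
  have hcont : Continuous fun s : ℝ => ‖p + s • q‖⁻¹ * s := by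
    have h0 : Continuous fun s : ℝ => p + s • q := by fun_prop
    exact (h0.norm.inv₀ fun s => norm_ne_zero_iff.2 (hnorm s)).mul continuous_id
  have hpos : 0 < φ (γ (δ / 2)) := by
    rw [hφγ]
    exact mul_pos (inv_pos.2 (norm_pos_iff.2 (hnorm _))) (by linarith)
  have hIcc : Icc 0 (φ (γ (δ / 2))) ⊆ φ '' edge x k l := by
    have := intermediate_value_Icc (by linarith : (0 : ℝ) ≤ δ / 2) hcont.continuousOn
    rw [mul_zero, ← hφγ] at this
    intro r hr
    obtain ⟨s, hs, rfl⟩ := this hr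
    exact ⟨γ s, hγ s hs, hφγ s⟩
  have hle := (measure_mono hIcc).trans (hφ.hausdorffMeasure_image_le zero_le_one (edge x k l))
  rw [hausdorffMeasure_real, Real.volume_Icc, sub_zero, ENNReal.coe_one, ENNReal.one_rpow,
    one_mul] at hle
  rw [mem_nbrs]
  exact ⟨hkl.symm, ENNReal.toReal_pos (lt_of_lt_of_le (ENNReal.ofReal_pos.2 hpos) hle).ne'
    (hausdorffMeasure_edge_lt_top hx hkl).ne⟩

/-- Three distinct generators are not collinear. -/
lemma smul_add_smul_ne_zero (hx : Function.Injective x) {k l m : Fin N} (hkl : k ≠ l)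
    (hkm : k ≠ m) (hlm : l ≠ m) {α β : ℝ} (h : α ≠ 0 ∨ β ≠ 0) :
    α • ((x k : E3) - x l) + β • ((x k : E3) - x m) ≠ 0 := by
  intro h0
  have hval : ∀ {i j : Fin N}, i ≠ j → (x i : E3) ≠ x j := fun hij e => hij (hx (Subtype.ext e))
  have hβ : β ≠ 0 := by
    intro hβ
    have hα : α ≠ 0 := h.resolve_right fun hh => hh hβ
    rw [hβ, zero_smul, add_zero, smul_eq_zero] at h0
    exact h0.elim hα (sub_ne_zero.2 (hval hkl))
  -- A line meets the sphere in at most two points: unit norm forces the coefficient to be `0` or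
  -- `-1`, that is `x m = x k` or `x m = x l`.
  have hm : (x m : E3) = x k + (α / β) • ((x k : E3) - x l) := by
    have h1 : β⁻¹ • (α • ((x k : E3) - x l) + β • ((x k : E3) - x m)) = 0 := by rw [h0, smul_zero]
    rw [smul_add, smul_smul, smul_smul, inv_mul_cancel₀ hβ, one_smul, mul_comm,
      ← div_eq_mul_inv] at h1
    have h2 : (x k : E3) + (α / β) • ((x k : E3) - x l) - x m = 0 := by
      refine Eq.trans ?_ h1
      abel
    exact (sub_eq_zero.1 h2).symm
  set c := α / β
  have hs : inner ℝ (x k : E3) (x l : E3) < 1 := inner_S2_lt_one fun e => hkl (hx e)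
  set s := inner ℝ (x k : E3) (x l : E3)
  have hn : ‖(x m : E3)‖ ^ 2 = 1 + 2 * c * (1 - s) + c ^ 2 * (2 - 2 * s) := by
    rw [hm, norm_add_sq_real, norm_smul, mul_pow, norm_sub_sq_real, real_inner_smul_right,
      inner_sub_right, real_inner_self_eq_norm_sq, norm_S2, norm_S2, Real.norm_eq_abs, sq_abs]
    ring
  rw [norm_S2] at hn
  have h3 : c * (1 + c) * (1 - s) = 0 := by linarith
  rcases mul_eq_zero.1 h3 with h3 | h3
  · rcases mul_eq_zero.1 h3 with h3 | h3
    · rw [h3, zero_smul, add_zero] at hm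
      exact hval hkm hm.symm
    · rw [show c = -1 by linarith] at hm
      refine hval hlm ?_
      rw [hm]; module
  · linarith

/-- For almost every end point, the segment from a generator meets at most two closed cells at a
time. -/
lemma ae_segment_generic (hx : Function.Injective x) (i : Fin N) :
    ∀ᵐ z : E3, ∀ t ∈ Icc (0 : ℝ) 1, ∀ k l m, k ≠ l → k ≠ m → l ≠ m →
      (1 - t) • (x i : E3) + t • z ∈ closedCone x k →
      (1 - t) • (x i : E3) + t • z ∈ closedCone x l →
      (1 - t) • (x i : E3) + t • z ∉ closedCone x m := by
  -- Three cones meet inside a line through the origin. `n` is normal to a plane containing this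
  -- line and `x i`; it suffices that `z` avoids these finitely many planes.
  have h : ∀ k l m, k ≠ l → k ≠ m → l ≠ m → ∃ n : E3, n ≠ 0 ∧ inner ℝ n (x i : E3) = 0 ∧
      ∀ p : E3, p ∈ closedCone x k → p ∈ closedCone x l → p ∈ closedCone x m →
        inner ℝ n p = 0 := by
    intro k l m hkl hkm hlm
    have key : ∀ α β : ℝ, ∀ p : E3, p ∈ closedCone x k → p ∈ closedCone x l → p ∈ closedCone x m →
        inner ℝ (α • ((x k : E3) - x l) + β • ((x k : E3) - x m)) p = 0 := by
      intro α β p hk hl hm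
      have h1 : inner ℝ p (x k : E3) = inner ℝ p (x l : E3) := le_antisymm (hl k) (hk l)
      have h2 : inner ℝ p (x k : E3) = inner ℝ p (x m : E3) := le_antisymm (hm k) (hk m)
      rw [real_inner_comm, inner_add_right, real_inner_smul_right, real_inner_smul_right,
        inner_sub_right, inner_sub_right, h1, ← h2, h1]
      ring
    -- These coefficients make the combination orthogonal to `x i`; if both vanish, `x k - x l`
    -- already is.
    by_cases hne : inner ℝ ((x k : E3) - x m) (x i : E3) ≠ 0 ∨
        -inner ℝ ((x k : E3) - x l) (x i : E3) ≠ 0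
    · refine ⟨_, smul_add_smul_ne_zero hx hkl hkm hlm hne, ?_, key _ _⟩
      rw [inner_add_left, real_inner_smul_left, real_inner_smul_left]
      ring
    · push Not at hne
      refine ⟨_, smul_add_smul_ne_zero hx hkl hkm hlm (α := 1) (β := 0) (by simp), ?_, key _ _⟩
      rw [inner_add_left, real_inner_smul_left, real_inner_smul_left, neg_eq_zero.1 hne.2]
      ring
  choose! n hn0 hni hn using h
  have hae : ∀ᵐ z : E3, ∀ k l m, k ≠ l → k ≠ m → l ≠ m → inner ℝ (n k l m) z ≠ 0 := by
    simp only [ae_all_iff]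
    intro k l m h1 h2 h3
    exact measure_eq_zero_iff_ae_notMem.1 (volume_orthogonal_eq_zero (hn0 k l m h1 h2 h3))
  filter_upwards [hae] with z hz t ht k l m hkl hkm hlm hk hl hm
  have h1 := hn k l m hkl hkm hlm _ hk hl hm
  rw [inner_add_right, real_inner_smul_right, real_inner_smul_right, hni k l m hkl hkm hlm,
    mul_zero, zero_add] at h1
  rcases mul_eq_zero.1 h1 with h1 | h1
  · rw [h1, sub_zero, one_smul, zero_smul, add_zero] at hk hl
    have aux : ∀ k, (x i : E3) ∈ closedCone x k → k = i := by
      intro k hk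
      by_contra hki
      have h2 := hk i
      have h3 := mem_cell_iff.1 (generator_mem_cell hx i) k hki
      linarith
    exact hkl ((aux k hk).trans (aux l hl).symm)
  · exact hz k l m hkl hkm hlm h1

end Grid

/-! ### Oscillation along segments and the potential estimate -/

section Grid

variable {N : ℕ} (x : Fin N → S2)

/-- The total jump of a grid function across the edges of a cell. -/
noncomputable def jump (u : Fin N → ℝ) (k : Fin N) : ℝ := ∑ j ∈ nbrs x k, |u k - u j|

/-- The kernel `h / (d + h)`, with `d` the distance of two generators and `h` the mesh size. -/
noncomputable def kern (i k : Fin N) : ℝ := meshSize x / (‖(x i : E3) - x k‖ + meshSize x)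

/-- The weighted sum of all jumps seen from `x i`. -/
noncomputable def potential (u : Fin N → ℝ) (i : Fin N) : ℝ := ∑ k, jump x u k * kern x i k

variable {x}

lemma jump_nonneg (u : Fin N → ℝ) (k : Fin N) : 0 ≤ jump x u k :=
  Finset.sum_nonneg fun _ _ => abs_nonneg _

/-- Along a generic segment, the values of a grid function differ by at most the sum of the jumps
of the visited cells. -/
lemma abs_sub_le_sum_jump (hx : Function.Injective x) (hN : 3 ≤ N) (u : Fin N → ℝ) {i K : Fin N}
    {z : E3}
    (hgen : ∀ t ∈ Icc (0 : ℝ) 1, ∀ k l m, k ≠ l → k ≠ m → l ≠ m →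
      (1 - t) • (x i : E3) + t • z ∈ closedCone x k →
      (1 - t) • (x i : E3) + t • z ∈ closedCone x l →
      (1 - t) • (x i : E3) + t • z ∉ closedCone x m)
    (hK : z ∈ closedCone x K) (S : Finset (Fin N))
    (hS : ∀ t ∈ Icc (0 : ℝ) 1, ∀ k, (1 - t) • (x i : E3) + t • z ∈ closedCone x k → k ∈ S) :
    |u i - u K| ≤ ∑ k ∈ S, jump x u k := by
  have : Nonempty (Fin N) := ⟨i⟩
  set p : ℝ → E3 := fun t => (1 - t) • (x i : E3) + t • z with hp
  have hpc : Continuous p := by fun_prop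
  -- A level-set argument, with no ordering of the visited cells: for each intermediate `c`, the
  -- closed parameter sets where `u ≤ c` and `u > c` cover the connected segment and hence meet, at
  -- a crossing between neighbouring cells. Comparing lengths then gives the claim.
  have hcross : Ico (min (u i) (u K)) (max (u i) (u K)) ⊆
      ⋃ k ∈ S, ⋃ l ∈ nbrs x k, uIcc (u l) (u k) := by
    intro c hc
    let A : Set ℝ := ⋃ k ∈ {k | u k ≤ c}, p ⁻¹' closedCone x k
    let B : Set ℝ := ⋃ k ∈ {k | c < u k}, p ⁻¹' closedCone x k
    have hA : IsClosed A := Set.Finite.isClosed_biUnion (Set.toFinite _) fun k _ =>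
      (isClosed_closedCone k).preimage hpc
    have hB : IsClosed B := Set.Finite.isClosed_biUnion (Set.toFinite _) fun k _ =>
      (isClosed_closedCone k).preimage hpc
    have h0 : (0 : ℝ) ∈ p ⁻¹' closedCone x i := by
      simp only [mem_preimage, hp, sub_zero, one_smul, zero_smul, add_zero]
      exact cell_subset_closedCone (generator_mem_cell hx i)
    have h1 : (1 : ℝ) ∈ p ⁻¹' closedCone x K := by
      simpa only [mem_preimage, hp, sub_self, one_smul, zero_smul, zero_add] using hK
    have hcov : Icc (0 : ℝ) 1 ⊆ A ∪ B := by
      intro t _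
      obtain ⟨k, hk⟩ := exists_mem_closedCone (x := x) (p t)
      rcases le_or_gt (u k) c with h | h
      · exact Or.inl (mem_biUnion (x := k) h hk)
      · exact Or.inr (mem_biUnion (x := k) h hk)
    have hAB : (Icc (0 : ℝ) 1 ∩ A).Nonempty ∧ (Icc (0 : ℝ) 1 ∩ B).Nonempty := by
      rcases le_total (u i) (u K) with h | h
      · rw [min_eq_left h, max_eq_right h] at hc
        exact ⟨⟨0, by simp, mem_biUnion (x := i) hc.1 h0⟩, ⟨1, by simp, mem_biUnion (x := K) hc.2 h1⟩⟩
      · rw [min_eq_right h, max_eq_left h] at hc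
        exact ⟨⟨1, by simp, mem_biUnion (x := K) hc.1 h1⟩, ⟨0, by simp, mem_biUnion (x := i) hc.2 h0⟩⟩
    obtain ⟨t, ht, htA, htB⟩ := isPreconnected_closed_iff.1 isPreconnected_Icc A B hA hB hcov
      hAB.1 hAB.2
    simp only [A, B, mem_iUnion, mem_ofPred_eq, mem_preimage, exists_prop] at htA htB
    obtain ⟨k, hkc, hk⟩ := htA
    obtain ⟨l, hlc, hl⟩ := htB
    have hkl : k ≠ l := by rintro rfl; linarith
    -- The origin lies in every cone, and with three generators genericity excludes it.
    have hpt : p t ≠ 0 := by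
      intro h0
      obtain ⟨m, hm⟩ : ∃ m : Fin N, m ∉ ({k, l} : Finset (Fin N)) := by
        by_contra hall
        push Not at hall
        have := Finset.card_le_card (fun a _ => hall a : Finset.univ ⊆ ({k, l} : Finset (Fin N)))
        rw [Finset.card_univ, Fintype.card_fin] at this
        have := Finset.card_le_two (a := k) (b := l)
        omega
      simp only [Finset.mem_insert, Finset.mem_singleton, not_or] at hm
      refine hgen t ht k l m hkl (Ne.symm hm.1) (Ne.symm hm.2) hk hl ?_
      change p t ∈ closedCone x m
      rw [h0]
      intro j
      simp
    have hnb : l ∈ nbrs x k := by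
      refine mem_nbrs_of_mem_closedCone hx hkl hpt hk hl fun j hjk hjl => ?_
      refine lt_of_le_of_ne (hk j) fun e => ?_
      exact hgen t ht k l j hkl (Ne.symm hjk) (Ne.symm hjl) hk hl fun m => (hk m).trans e.ge
    refine mem_biUnion (x := k) (hS t ht k hk) (mem_biUnion (x := l) hnb ?_)
    rw [uIcc_of_ge (hkc.trans hlc.le)]
    exact ⟨hkc, hlc.le⟩
  have hvol : volume (Ico (min (u i) (u K)) (max (u i) (u K))) ≤
      ∑ k ∈ S, ∑ l ∈ nbrs x k, ENNReal.ofReal |u k - u l| := by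
    refine (measure_mono hcross).trans ((measure_biUnion_finset_le _ _).trans ?_)
    refine Finset.sum_le_sum fun k _ => (measure_biUnion_finset_le _ _).trans ?_
    simp only [Real.volume_interval]
    exact le_rfl
  rw [Real.volume_Ico, max_sub_min_eq_abs', ← ENNReal.ofReal_toReal
    (a := ∑ k ∈ S, ∑ l ∈ nbrs x k, ENNReal.ofReal |u k - u l|) (by simp)] at hvol
  have h2 := (ENNReal.ofReal_le_ofReal_iff ENNReal.toReal_nonneg).1 hvol
  refine h2.trans (le_of_eq ?_)
  rw [ENNReal.toReal_sum (by simp)]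
  refine Finset.sum_congr rfl fun k _ => ?_
  rw [ENNReal.toReal_sum (by simp), jump]
  exact Finset.sum_congr rfl fun l _ => ENNReal.toReal_ofReal (abs_nonneg _)

/-- If the segment from `x i` to a point `z` of the unit ball, not close to the antipode of `x i`,
visits the cell of `x k`, then `z` lies in a thin slab around the plane of `x i` and `x k`. -/
lemma abs_inner_le_of_segment_mem (hx : Function.Injective x) (hh : 0 < meshSize x)
    {i k : Fin N} {ν z : E3}
    (hν : ‖ν‖ = 1) (hνi : inner ℝ ν (x i : E3) = 0) (hνk : inner ℝ ν (x k : E3) = 0)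
    (hz : ‖z‖ ≤ 1)
    (hzi : -‖z - inner ℝ (x i : E3) z • (x i : E3)‖ ≤ inner ℝ (x i : E3) z)
    {t : ℝ} (ht : t ∈ Icc (0 : ℝ) 1) (hk : (1 - t) • (x i : E3) + t • z ∈ closedCone x k) :
    |inner ℝ ν z| ≤ 12 * kern x i k := by
  set h := meshSize x
  set a : E3 := (x i : E3)
  set d := ‖a - x k‖ with hd
  have ha : ‖a‖ = 1 := norm_S2 _
  have hd0 : 0 ≤ d := norm_nonneg _
  have hνz : |inner ℝ ν z| ≤ 1 := abs_inner_le_of_norm_le hν hz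
  rw [kern]
  change _ ≤ 12 * (h / (d + h))
  -- For nearby generators the right-hand side is at least `4`, and nothing is to be shown.
  rcases lt_or_ge d (2 * h) with hdh | hdh
  · refine hνz.trans ?_
    rw [← mul_div_assoc, le_div_iff₀ (by linarith)]
    linarith
  set w : E3 := (1 - t) • a + t • z with hw
  have h1 : ‖w - ‖w‖ • (x k : E3)‖ ≤ h * ‖w‖ := norm_sub_le_of_mem_closedCone hx hk
  set zp : E3 := z - inner ℝ a z • a with hzp
  set c := inner ℝ a z with hc
  have hzdec : z = c • a + zp := by rw [hzp]; abel
  have hazp : inner ℝ a zp = 0 := by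
    rw [hzp, inner_sub_right, real_inner_smul_right, real_inner_self_eq_norm_sq, ha]; ring
  have hzp1 : ‖zp‖ ≤ 1 := by
    have h2 : ‖z‖ ^ 2 = c ^ 2 + ‖zp‖ ^ 2 := by
      rw [hzdec, norm_add_sq_real, real_inner_smul_left, hazp, norm_smul, ha, Real.norm_eq_abs,
        mul_one, sq_abs]; ring
    nlinarith [sq_nonneg c, norm_nonneg z, norm_nonneg zp]
  set s := (1 - t) + t * c with hs
  set P := t * ‖zp‖ with hP
  have hP0 : 0 ≤ P := mul_nonneg ht.1 (norm_nonneg _)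
  have hPt : P ≤ t := mul_le_of_le_one_right ht.1 hzp1
  have hwdec : w = s • a + t • zp := by
    rw [hw, hs]; nth_rewrite 1 [hzdec]; module
  have hsP : -P ≤ s := by
    have := mul_le_mul_of_nonneg_left hzi ht.1
    rw [hs, hP]
    linarith [ht.2]
  have hwn : ‖w‖ ≤ |s| + P := by
    rw [hwdec]
    refine (norm_add_le _ _).trans (le_of_eq ?_)
    rw [norm_smul, norm_smul, ha, mul_one, Real.norm_eq_abs, Real.norm_eq_abs, abs_of_nonneg ht.1]
  have hsw : s ≤ ‖w‖ := by
    have h2 : inner ℝ a w = s := by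
      rw [hwdec, inner_add_right, real_inner_smul_right, real_inner_smul_right, hazp,
        real_inner_self_eq_norm_sq, ha]; ring
    rw [← h2]
    exact (real_inner_le_norm a w).trans (by rw [ha, one_mul])
  -- A point at parameter `t` has turned away from `a` by at most order `t`. For `s < 0`, the
  -- condition `-P ≤ s` gives `‖w‖ - s ≤ 3 * P`.
  have hwa : ‖‖w‖ • a - w‖ ≤ 4 * t := by
    have h2 : ‖w‖ • a - w = (‖w‖ - s) • a - t • zp := by nth_rewrite 2 [hwdec]; module
    rw [h2]
    refine (norm_sub_le _ _).trans ?_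
    rw [norm_smul, norm_smul, ha, mul_one, Real.norm_eq_abs, Real.norm_eq_abs,
      abs_of_nonneg ht.1, abs_of_nonneg (by linarith)]
    rcases abs_cases s with ⟨h3, _⟩ | ⟨h3, _⟩ <;> rw [h3] at hwn <;> linarith
  have hwd : ‖w‖ * d ≤ 4 * t + h * ‖w‖ := by
    have h2 : ‖w‖ * d = ‖‖w‖ • a - ‖w‖ • (x k : E3)‖ := by
      rw [← smul_sub, norm_smul, norm_norm]
    rw [h2]
    refine (norm_sub_le_norm_sub_add_norm_sub _ w _).trans ?_
    exact add_le_add hwa h1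
  -- Uses `d - h ≥ (d + h) / 3`, valid since `d ≥ 2 * h`.
  have hwd2 : ‖w‖ * (d + h) ≤ 12 * t := by nlinarith [norm_nonneg w]
  -- `ν` annihilates both generators, so only the deviation of `w` from the ray of `x k` remains.
  have hin : t * inner ℝ ν z = inner ℝ ν (w - ‖w‖ • (x k : E3)) := by
    rw [inner_sub_right, real_inner_smul_right, hνk, hw, inner_add_right, real_inner_smul_right,
      real_inner_smul_right, hνi]; ring
  have ht0 : 0 < t := by
    refine lt_of_le_of_ne ht.1 fun h0 => ?_
    have hwa' : w = a := by rw [hw, ← h0]; simp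
    rw [hwa', ha, ← h0] at hwd2
    linarith
  have h3 : t * |inner ℝ ν z| ≤ h * ‖w‖ := by
    rw [← abs_of_pos ht0, ← abs_mul, hin]
    exact abs_inner_le_of_norm_le hν h1
  rw [← mul_div_assoc, le_div_iff₀ (by linarith)]
  have h4 : t * (|inner ℝ ν z| * (d + h)) ≤ t * (12 * h) := by
    calc t * (|inner ℝ ν z| * (d + h)) = t * |inner ℝ ν z| * (d + h) := by ring
      _ ≤ h * ‖w‖ * (d + h) := mul_le_mul_of_nonneg_right h3 (by linarith)
      _ = h * (‖w‖ * (d + h)) := by ring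
      _ ≤ h * (12 * t) := mul_le_mul_of_nonneg_left hwd2 hh.le
      _ = t * (12 * h) := by ring
  exact le_of_mul_le_mul_left h4 ht0

/-- Endpoints near `ν / 2` are almost orthogonal to `a`: the component along `a` is at most `1/8`,
while the norm is at least `3/8`. -/
lemma neg_norm_le_inner {a ν z : E3} (ha : ‖a‖ = 1) (hν : ‖ν‖ = 1) (hνa : inner ℝ ν a = 0)
    (hz : ‖z - (1 / 2 : ℝ) • ν‖ ≤ 1 / 8) : -‖z - inner ℝ a z • a‖ ≤ inner ℝ a z := by
  have h1 : |inner ℝ a z| ≤ 1 / 8 := by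
    have : inner ℝ a z = inner ℝ a (z - (1 / 2 : ℝ) • ν) := by
      rw [inner_sub_right, real_inner_smul_right, real_inner_comm ν a, hνa]
      ring
    rw [this]
    exact abs_inner_le_of_norm_le ha hz
  have h2 : 1 / 2 - 1 / 8 ≤ ‖z‖ := by
    have h3 : ‖(1 / 2 : ℝ) • ν‖ = 1 / 2 := by rw [norm_smul, hν]; norm_num
    have h4 := norm_sub_norm_le ((1 / 2 : ℝ) • ν) z
    rw [norm_sub_rev, h3] at h4
    linarith
  have h5 := norm_sub_norm_le z (inner ℝ a z • a)
  rw [norm_smul, ha, mul_one, Real.norm_eq_abs] at h5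
  linarith [neg_abs_le (inner ℝ a z)]

lemma kern_nonneg (hh : 0 < meshSize x) (i k : Fin N) : 0 ≤ kern x i k :=
  div_nonneg hh.le (by positivity)

/-- The difference of two values of a grid function is controlled by the potentials of its jumps. -/
lemma volume_mul_abs_sub_le (hx : Function.Injective x) (hN : 3 ≤ N) (hh : 0 < meshSize x)
    (u : Fin N → ℝ) (i j : Fin N) :
    volume.real (Metric.ball (0 : E3) (1 / 8)) * |u i - u j| ≤
      96 * (potential x u i + potential x u j) := by
  have : Nonempty (Fin N) := ⟨i⟩
  -- A normal to both generators allows one ball `Q` of endpoints to serve both families of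
  -- segments.
  obtain ⟨ν, hν, hνi, hνj⟩ := exists_unit_normal (x i : E3) (x j : E3)
  choose n hn hn1 hn2 using fun i k => exists_unit_normal (x i : E3) (x k : E3)
  let B : Fin N → Fin N → Set E3 := fun i k =>
    {z | ‖z‖ ≤ 1 ∧ |inner ℝ (n i k) z| ≤ 12 * kern x i k}
  have hBm : ∀ i k, MeasurableSet (B i k) := by
    intro i k
    have h1 : IsClosed {z : E3 | ‖z‖ ≤ 1} := isClosed_le (by fun_prop) (by fun_prop)
    have h2 : IsClosed {z : E3 | |inner ℝ (n i k) z| ≤ 12 * kern x i k} :=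
      isClosed_le (by fun_prop) (by fun_prop)
    exact (h1.inter h2).measurableSet
  have hBvol : ∀ i k, volume (B i k) ≤ ENNReal.ofReal (96 * kern x i k) := by
    intro i k
    refine (volume_slab_le _ (hn i k) (mul_nonneg (by norm_num) (kern_nonneg hh i k))).trans ?_
    exact ENNReal.ofReal_le_ofReal (by linarith)
  let Q : Set E3 := Metric.ball ((1 / 2 : ℝ) • ν) (1 / 8)
  let g : E3 → ENNReal := fun z => ∑ k, ENNReal.ofReal (jump x u k) *
    ((B i k).indicator 1 z + (B j k).indicator 1 z)
  have hpt : ∀ᵐ z ∂(volume.restrict Q), ENNReal.ofReal |u i - u j| ≤ g z := by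
    rw [ae_restrict_iff' Metric.isOpen_ball.measurableSet]
    filter_upwards [ae_segment_generic hx i, ae_segment_generic hx j] with z hzi hzj hzQ
    have hzQ' : ‖z - (1 / 2 : ℝ) • ν‖ ≤ 1 / 8 := (mem_ball_iff_norm.1 hzQ).le
    have hz1 : ‖z‖ ≤ 1 := by
      have h3 : ‖(1 / 2 : ℝ) • ν‖ = 1 / 2 := by rw [norm_smul, hν]; norm_num
      have := norm_le_norm_add_norm_sub' z ((1 / 2 : ℝ) • ν)
      linarith
    obtain ⟨K, hK⟩ := exists_mem_closedCone (x := x) z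
    classical
    have hone : ∀ i, (∀ t ∈ Icc (0 : ℝ) 1, ∀ k l m, k ≠ l → k ≠ m → l ≠ m →
        (1 - t) • (x i : E3) + t • z ∈ closedCone x k →
        (1 - t) • (x i : E3) + t • z ∈ closedCone x l →
        (1 - t) • (x i : E3) + t • z ∉ closedCone x m) → inner ℝ ν (x i : E3) = 0 →
        ENNReal.ofReal |u i - u K| ≤
          ∑ k, ENNReal.ofReal (jump x u k) * (B i k).indicator 1 z := by
      intro i hgen hνi
      have h1 := abs_sub_le_sum_jump hx hN u hgen hK (Finset.univ.filter fun k => z ∈ B i k) (by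
        intro t ht k hk
        refine Finset.mem_filter.2 ⟨Finset.mem_univ _, hz1, ?_⟩
        exact abs_inner_le_of_segment_mem hx hh (hn i k) (hn1 i k) (hn2 i k) hz1
          (neg_norm_le_inner (norm_S2 _) hν hνi hzQ') ht hk)
      refine (ENNReal.ofReal_le_ofReal h1).trans (le_of_eq ?_)
      rw [ENNReal.ofReal_sum_of_nonneg fun k _ => jump_nonneg u k, Finset.sum_filter]
      refine Finset.sum_congr rfl fun k _ => ?_
      simp [Set.indicator_apply]
    calc ENNReal.ofReal |u i - u j| ≤ ENNReal.ofReal (|u i - u K| + |u j - u K|) :=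
          ENNReal.ofReal_le_ofReal (by
            rw [abs_sub_comm (u j)]; exact abs_sub_le _ _ _)
      _ = ENNReal.ofReal |u i - u K| + ENNReal.ofReal |u j - u K| :=
          ENNReal.ofReal_add (abs_nonneg _) (abs_nonneg _)
      _ ≤ _ := add_le_add (hone i hzi hνi) (hone j hzj hνj)
      _ = g z := by
        rw [← Finset.sum_add_distrib]
        exact Finset.sum_congr rfl fun k _ => (mul_add _ _ _).symm
  have hQ : volume Q = volume (Metric.ball (0 : E3) (1 / 8)) := Measure.addHaar_ball_center _ _ _
  have hint : volume Q * ENNReal.ofReal |u i - u j| ≤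
      ∑ k, ENNReal.ofReal (jump x u k) * ENNReal.ofReal (96 * kern x i k + 96 * kern x j k) := by
    calc volume Q * ENNReal.ofReal |u i - u j|
        = ∫⁻ _ in Q, ENNReal.ofReal |u i - u j| := by rw [setLIntegral_const, mul_comm]
      _ ≤ ∫⁻ z in Q, g z := lintegral_mono_ae hpt
      _ ≤ ∫⁻ z, g z := setLIntegral_le_lintegral _ _
      _ = ∑ k, ENNReal.ofReal (jump x u k) * (volume (B i k) + volume (B j k)) := by
        rw [lintegral_finsetSum]
        · refine Finset.sum_congr rfl fun k _ => ?_
          rw [lintegral_const_mul, lintegral_add_left, lintegral_indicator_one (hBm i k),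
            lintegral_indicator_one (hBm j k)]
          · exact measurable_one.indicator (hBm i k)
          · exact (measurable_one.indicator (hBm i k)).add (measurable_one.indicator (hBm j k))
        · exact fun k _ => ((measurable_one.indicator (hBm i k)).add
            (measurable_one.indicator (hBm j k))).const_mul _
      _ ≤ _ := by
        refine Finset.sum_le_sum fun k _ => mul_le_mul_right ?_ _
        rw [ENNReal.ofReal_add (mul_nonneg (by norm_num) (kern_nonneg hh i k))
          (mul_nonneg (by norm_num) (kern_nonneg hh j k))]
        exact add_le_add (hBvol i k) (hBvol j k)
  have hnn : ∀ k, 0 ≤ 96 * kern x i k + 96 * kern x j k := fun k =>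
    add_nonneg (mul_nonneg (by norm_num) (kern_nonneg hh i k))
      (mul_nonneg (by norm_num) (kern_nonneg hh j k))
  have hsum : ∑ k, ENNReal.ofReal (jump x u k) * ENNReal.ofReal (96 * kern x i k + 96 * kern x j k)
      = ENNReal.ofReal (96 * (potential x u i + potential x u j)) := by
    have : 96 * (potential x u i + potential x u j) =
        ∑ k, jump x u k * (96 * kern x i k + 96 * kern x j k) := by
      rw [potential, potential, ← Finset.sum_add_distrib, Finset.mul_sum]
      exact Finset.sum_congr rfl fun k _ => by ring
    rw [this, ENNReal.ofReal_sum_of_nonneg fun k _ => mul_nonneg (jump_nonneg u k) (hnn k)]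
    exact Finset.sum_congr rfl fun k _ => (ENNReal.ofReal_mul (jump_nonneg u k)).symm
  have hpot : ∀ i, 0 ≤ potential x u i := fun i =>
    Finset.sum_nonneg fun k _ => mul_nonneg (jump_nonneg u k) (kern_nonneg hh i k)
  rw [hsum, hQ] at hint
  have := ENNReal.toReal_mono ENNReal.ofReal_ne_top hint
  rwa [ENNReal.toReal_mul, ENNReal.toReal_ofReal (abs_nonneg _), ENNReal.toReal_ofReal
    (mul_nonneg (by norm_num) (add_nonneg (hpot i) (hpot j)))] at this

end Grid

/-! ### Packing, kernel sums and the Poincaré inequality -/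

section Grid

variable {N : ℕ} (x : Fin N → S2)

/-- The discrete Dirichlet energy with unit weights. -/
noncomputable def dirichlet (u : Fin N → ℝ) : ℝ := ∑ k, ∑ j ∈ nbrs x k, (u k - u j) ^ 2

variable {x} {C₀ C₁ : ℝ}

lemma three_le_card {T : Finset (Finset (Fin N))} (hT : IsDelaunay x T) : 3 ≤ N := by
  obtain ⟨ν, hν, -⟩ := exists_unit_normal 0 0
  obtain ⟨t, ht, -⟩ := hT.cover ⟨ν, by simpa using hν⟩
  have := Finset.card_le_univ t
  rwa [hT.card_eq t ht, Fintype.card_fin] at this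

lemma area_real_univ_pos : 0 < area.real (univ : Set S2) := by
  obtain ⟨ν, hν, -⟩ := exists_unit_normal 0 0
  have : (univ : Set S2).Nonempty := ⟨⟨ν, by simpa using hν⟩, trivial⟩
  exact ENNReal.toReal_pos (isOpen_univ.measure_pos area this).ne' (measure_ne_top _ _)

/-- With mesh size zero the upper area bound would make all cells null, yet they cover almost all of
the sphere. -/
lemma meshSize_pos [Nonempty (Fin N)] (hx : Function.Injective x) (hA : AlmostUniform x C₀ C₁) :
    0 < meshSize x := by
  obtain ⟨i⟩ := ‹Nonempty (Fin N)›
  refine lt_of_le_of_ne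
    ((norm_nonneg _).trans (norm_sub_le_meshSize_of_mem_cell (generator_mem_cell hx i))) fun h0 => ?_
  have hz : ∀ k, area (cell x k) = 0 := by
    intro k
    have := hA.cell_upper k
    rw [← h0, zero_pow two_ne_zero, mul_zero] at this
    exact (measureReal_eq_zero_iff).1 (le_antisymm this measureReal_nonneg)
  have : Nonempty (Fin N) := ⟨i⟩
  have h1 : area (univ : Set S2) ≤ 0 := by
    have h2 : area (⋃ k, cell x k) = 0 := measure_iUnion_null hz
    rw [← h2]
    refine measure_mono_ae ?_
    filter_upwards [ae_exists_mem_cell hx] with y hy _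
    exact mem_iUnion.2 hy
  have h3 := area_real_univ_pos
  rw [measureReal_def, nonpos_iff_eq_zero.1 h1] at h3
  exact lt_irrefl _ h3

/-- The number of generators in a cap is at most quadratic in its relative radius. -/
lemma card_mul_sq_le (hC₁ : 0 < C₁) (hA : AlmostUniform x C₀ C₁)
    (hh : 0 < meshSize x) (i : Fin N) {r : ℝ} (hr : meshSize x ≤ r) (F : Finset (Fin N))
    (hF : ∀ k ∈ F, ‖(x i : E3) - x k‖ ≤ r) :
    (F.card : ℝ) * meshSize x ^ 2 ≤ 96 * C₁ * r ^ 2 := by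
  have h1 : area.real (⋃ k ∈ F, cell x k) = ∑ k ∈ F, area.real (cell x k) :=
    measureReal_biUnion_finset (fun k _ l _ hkl => cell_disjoint hkl)
      fun k _ => measurableSet_cell k
  -- The disjoint cells fit in a cap of radius `r + h ≤ 2 * r`.
  have h2 : area.real (⋃ k ∈ F, cell x k) ≤ 24 * (2 * r) ^ 2 := by
    refine (measureReal_mono ?_).trans (area_real_ball_le (x i) (by linarith))
    intro y hy
    obtain ⟨k, hk, hyk⟩ := mem_iUnion₂.1 hy
    change ‖(y : E3) - x i‖ ≤ 2 * r
    rw [norm_sub_rev]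
    have := norm_sub_le_norm_sub_add_norm_sub (x i : E3) (x k) y
    linarith [hF k hk, norm_sub_le_meshSize_of_mem_cell hyk]
  have h3 : (F.card : ℝ) * (1 / C₁ * meshSize x ^ 2) ≤ ∑ k ∈ F, area.real (cell x k) := by
    rw [← nsmul_eq_mul]
    exact Finset.card_nsmul_le_sum _ _ _ fun k _ => hA.cell_lower k
  have h4 : (F.card : ℝ) * (1 / C₁ * meshSize x ^ 2) ≤ 24 * (2 * r) ^ 2 := by linarith
  calc (F.card : ℝ) * meshSize x ^ 2 = C₁ * ((F.card : ℝ) * (1 / C₁ * meshSize x ^ 2)) := by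
        field_simp
    _ ≤ C₁ * (24 * (2 * r) ^ 2) := mul_le_mul_of_nonneg_left h4 hC₁.le
    _ = _ := by ring

lemma card_nbrs_le (hC₁ : 0 < C₁) (hA : AlmostUniform x C₀ C₁)
    (hh : 0 < meshSize x) (k : Fin N) : ((nbrs x k).card : ℝ) ≤ 384 * C₁ := by
  have h1 := card_mul_sq_le hC₁ hA hh k (r := 2 * meshSize x) (by linarith) (nbrs x k)
    fun j hj => by rw [norm_sub_rev]; exact norm_sub_le_of_mem_nbrs hj
  have h2 : 0 < meshSize x ^ 2 := by positivity
  refine le_of_mul_le_mul_right ?_ h2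
  linarith

lemma sum_jump_sq_le (hC₁ : 0 < C₁) (hA : AlmostUniform x C₀ C₁)
    (hh : 0 < meshSize x) (u : Fin N → ℝ) :
    ∑ k, jump x u k ^ 2 ≤ 384 * C₁ * dirichlet x u := by
  rw [dirichlet, Finset.mul_sum]
  refine Finset.sum_le_sum fun k _ => ?_
  refine sq_sum_le_card_mul_sum_sq.trans ?_
  simp only [sq_abs]
  exact mul_le_mul_of_nonneg_right (card_nbrs_le hC₁ hA hh k)
    (Finset.sum_nonneg fun _ _ => sq_nonneg _)

lemma kern_comm (i k : Fin N) : kern x i k = kern x k i := by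
  rw [kern, kern, norm_sub_rev]

/-- Dyadic decomposition of powers of the kernel. -/
lemma sum_kern_pow_le (hC₁ : 0 < C₁) (hA : AlmostUniform x C₀ C₁)
    (hh : 0 < meshSize x) {M : ℕ} (hM : 2 ≤ 2 ^ M * meshSize x) (p : ℕ) (i : Fin N) :
    ∑ k, kern x i k ^ p ≤
      ∑ m ∈ Finset.range (M + 1), (2 / 2 ^ m : ℝ) ^ p * (96 * C₁ * (2 ^ m) ^ 2) := by
  classical
  set h := meshSize x
  have hpt : ∀ k, kern x i k ^ p ≤ ∑ m ∈ Finset.range (M + 1),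
      if ‖(x i : E3) - x k‖ ≤ 2 ^ m * h then (2 / 2 ^ m : ℝ) ^ p else 0 := by
    intro k
    set d := ‖(x i : E3) - x k‖ with hd
    have hd0 : 0 ≤ d := norm_nonneg _
    have hd2 : d ≤ 2 := (norm_sub_le _ _).trans (by rw [norm_S2, norm_S2]; norm_num)
    -- At the least such scale `m > 0`, minimality gives `d > 2 ^ (m - 1) * h`, hence the kernel
    -- bound.
    have hex : ∃ m : ℕ, d ≤ 2 ^ m * h := ⟨M, hd2.trans hM⟩
    have hle : Nat.find hex ≤ M := Nat.find_min' hex (hd2.trans hM)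
    have hspec := Nat.find_spec hex
    set m := Nat.find hex with hm
    have hk : kern x i k ≤ 2 / 2 ^ m := by
      change h / (d + h) ≤ _
      rw [div_le_div_iff₀ (by linarith) (by positivity)]
      rcases Nat.eq_zero_or_pos m with h0 | h0
      · rw [h0]; linarith
      · have h1 := Nat.find_min hex (m := m - 1) (by omega)
        rw [not_le] at h1
        have h2 : (2 : ℝ) ^ m = 2 * 2 ^ (m - 1) := by
          rw [← pow_succ']; congr 1; omega
        rw [h2]
        linarith
    refine (pow_le_pow_left₀ (kern_nonneg hh i k) hk p).trans ?_
    have h3 := Finset.single_le_sum (f := fun m => if d ≤ 2 ^ m * h then (2 / 2 ^ m : ℝ) ^ p else 0)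
      (fun m _ => by split_ifs <;> positivity)
      (Finset.mem_range.2 (Nat.lt_succ_of_le hle))
    simp only [if_pos hspec] at h3
    exact h3
  refine (Finset.sum_le_sum fun k _ => hpt k).trans ?_
  rw [Finset.sum_comm]
  refine Finset.sum_le_sum fun m _ => ?_
  rw [← Finset.sum_filter, Finset.sum_const, nsmul_eq_mul, mul_comm]
  refine mul_le_mul_of_nonneg_left ?_ (by positivity)
  have h1 : (1 : ℝ) ≤ 2 ^ m := one_le_pow₀ (by norm_num)
  have h2 := card_mul_sq_le hC₁ hA hh i (r := 2 ^ m * h) (by nlinarith)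
    (Finset.univ.filter fun k => ‖(x i : E3) - x k‖ ≤ 2 ^ m * h)
    fun k hk => (Finset.mem_filter.1 hk).2
  refine le_of_mul_le_mul_right ?_ (by positivity : 0 < h ^ 2)
  exact h2.trans (le_of_eq (by ring))

/-- The number of dyadic scales between the mesh size and the diameter of the sphere. -/
lemma exists_dyadic_scale {h : ℝ} (h0 : 0 < h) (h1 : h < 1) :
    ∃ M : ℕ, 2 ≤ 2 ^ M * h ∧ 2 ^ M * h ≤ 4 ∧ (M : ℝ) ≤ 2 + 2 * |Real.log h| := by
  have hex : ∃ M : ℕ, 2 ≤ 2 ^ M * h := by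
    obtain ⟨M, hM⟩ := pow_unbounded_of_one_lt (2 / h) one_lt_two
    exact ⟨M, ((div_lt_iff₀ h0).1 hM).le⟩
  have hspec := Nat.find_spec hex
  set M := Nat.find hex
  have hM0 : M ≠ 0 := by
    intro h0
    rw [h0] at hspec
    linarith
  have hmin := Nat.find_min hex (m := M - 1) (by omega)
  rw [not_le] at hmin
  have h2 : (2 : ℝ) ^ M = 2 * 2 ^ (M - 1) := by
    rw [← pow_succ']; congr 1; omega
  refine ⟨M, hspec, by rw [h2]; linarith, ?_⟩
  -- Taking logarithms bounds `M - 1` by `1 + |log h| / log 2`, and `log 2 > 1/2`.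
  have h3 := Real.log_lt_log (by positivity) hmin
  rw [Real.log_mul (by positivity) h0.ne', Real.log_pow, Nat.cast_sub (by omega), Nat.cast_one] at h3
  rw [abs_of_neg (Real.log_neg h0 h1)]
  have h4 := Real.log_two_gt_d9
  have h5 := Real.log_two_lt_d9
  have h6 := Real.log_neg h0 h1
  by_contra hcon
  push Not at hcon
  nlinarith

/-- In dimension two each dyadic scale contributes the same amount, so the sum counts scales: the
origin of the logarithm. -/
lemma sum_kern_sq_le (hC₁ : 0 < C₁) (hA : AlmostUniform x C₀ C₁)
    (hh : 0 < meshSize x) (h1 : meshSize x < 1) (i : Fin N) :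
    ∑ k, kern x i k ^ 2 ≤ 384 * C₁ * (3 + 2 * |Real.log (meshSize x)|) := by
  obtain ⟨M, hM, -, hMl⟩ := exists_dyadic_scale hh h1
  refine (sum_kern_pow_le hC₁ hA hh hM 2 i).trans ?_
  have : ∀ m ∈ Finset.range (M + 1),
      (2 / 2 ^ m : ℝ) ^ 2 * (96 * C₁ * (2 ^ m) ^ 2) = 384 * C₁ := by
    intro m _
    field_simp
    norm_num
  rw [Finset.sum_congr rfl this, Finset.sum_const, Finset.card_range, nsmul_eq_mul, mul_comm]
  refine mul_le_mul_of_nonneg_left ?_ (by positivity)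
  push_cast
  linarith

/-- Contributions now grow geometrically, and the coarsest scale, with `2 ^ M ≤ 4 / h`, dominates.
-/
lemma sum_kern_le (hC₁ : 0 < C₁) (hA : AlmostUniform x C₀ C₁)
    (hh : 0 < meshSize x) (h1 : meshSize x < 1) (i : Fin N) :
    ∑ k, kern x i k ≤ 1536 * C₁ / meshSize x := by
  obtain ⟨M, hM, hM4, -⟩ := exists_dyadic_scale hh h1
  have h2 := sum_kern_pow_le hC₁ hA hh hM 1 i
  simp only [pow_one] at h2
  refine h2.trans ?_
  have : ∀ m ∈ Finset.range (M + 1),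
      (2 / 2 ^ m : ℝ) * (96 * C₁ * (2 ^ m) ^ 2) = 192 * C₁ * 2 ^ m := by
    intro m _
    field_simp
    norm_num
  rw [Finset.sum_congr rfl this, ← Finset.mul_sum, geom_sum_eq (by norm_num), le_div_iff₀ hh,
    pow_succ]
  have h3 : ((2 : ℝ) ^ M * 2 - 1) / (2 - 1) * meshSize x ≤ 8 := by
    rw [show (2 : ℝ) - 1 = 1 by norm_num, div_one]
    linarith
  calc 192 * C₁ * (((2 : ℝ) ^ M * 2 - 1) / (2 - 1)) * meshSize x
      = 192 * C₁ * (((2 : ℝ) ^ M * 2 - 1) / (2 - 1) * meshSize x) := by ring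
    _ ≤ 192 * C₁ * 8 := mul_le_mul_of_nonneg_left h3 (by positivity)
    _ = _ := by ring

/-- The pointwise bound of the potential loses only a logarithm. -/
lemma potential_sq_le (hC₁ : 0 < C₁) (hA : AlmostUniform x C₀ C₁)
    (hh : 0 < meshSize x) (h1 : meshSize x < 1) (u : Fin N → ℝ) (i : Fin N) :
    potential x u i ^ 2 ≤
      384 * C₁ * dirichlet x u * (384 * C₁ * (3 + 2 * |Real.log (meshSize x)|)) := by
  refine (Finset.sum_mul_sq_le_sq_mul_sq _ _ _).trans ?_
  exact mul_le_mul (sum_jump_sq_le hC₁ hA hh u) (sum_kern_sq_le hC₁ hA hh h1 i)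
    (Finset.sum_nonneg fun _ _ => sq_nonneg _) (mul_nonneg (by positivity)
      (Finset.sum_nonneg fun _ _ => Finset.sum_nonneg fun _ _ => sq_nonneg _))

/-- Schur's test for the kernel. -/
lemma sum_potential_sq_le (hC₁ : 0 < C₁) (hA : AlmostUniform x C₀ C₁)
    (hh : 0 < meshSize x) (h1 : meshSize x < 1) (u : Fin N → ℝ) :
    ∑ i, potential x u i ^ 2 ≤
      (1536 * C₁ / meshSize x) ^ 2 * (384 * C₁ * dirichlet x u) := by
  set K := 1536 * C₁ / meshSize x
  have hK : 0 ≤ K := by positivity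
  have h2 : ∀ i, potential x u i ^ 2 ≤ K * ∑ k, jump x u k ^ 2 * kern x i k := by
    intro i
    refine (Finset.sum_sq_le_sum_mul_sum_of_sq_le_mul Finset.univ (f := fun k => kern x i k)
      (g := fun k => jump x u k ^ 2 * kern x i k) (fun k _ => kern_nonneg hh i k)
      (fun k _ => mul_nonneg (sq_nonneg _) (kern_nonneg hh i k)) fun k _ => le_of_eq (by ring)).trans ?_
    exact mul_le_mul_of_nonneg_right (sum_kern_le hC₁ hA hh h1 i)
      (Finset.sum_nonneg fun k _ => mul_nonneg (sq_nonneg _) (kern_nonneg hh i k))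
  calc ∑ i, potential x u i ^ 2 ≤ ∑ i, K * ∑ k, jump x u k ^ 2 * kern x i k :=
        Finset.sum_le_sum fun i _ => h2 i
    _ = K * ∑ k, jump x u k ^ 2 * ∑ i, kern x k i := by
        rw [← Finset.mul_sum, Finset.sum_comm]
        congr 1
        refine Finset.sum_congr rfl fun k _ => ?_
        rw [Finset.mul_sum]
        exact Finset.sum_congr rfl fun i _ => by rw [kern_comm]
    _ ≤ K * ∑ k, jump x u k ^ 2 * K := by
        refine mul_le_mul_of_nonneg_left (Finset.sum_le_sum fun k _ => ?_) hK
        exact mul_le_mul_of_nonneg_left (sum_kern_le hC₁ hA hh h1 k) (sq_nonneg _)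
    _ = K ^ 2 * ∑ k, jump x u k ^ 2 := by rw [← Finset.sum_mul]; ring
    _ ≤ _ := mul_le_mul_of_nonneg_left (sum_jump_sq_le hC₁ hA hh u) (sq_nonneg _)

lemma volume_ball_pos : 0 < volume.real (Metric.ball (0 : E3) (1 / 8)) :=
  ENNReal.toReal_pos (Metric.measure_ball_pos _ _ (by norm_num)).ne' measure_ball_lt_top.ne

/-- The discrete Poincaré inequality. -/
lemma exists_sum_area_mul_sq_le (hx : Function.Injective x) (hN : 3 ≤ N) (hC₁ : 0 < C₁)
    (hA : AlmostUniform x C₀ C₁) (hh : 0 < meshSize x) (h1 : meshSize x < 1) (u : Fin N → ℝ) :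
    ∃ c : ℝ, ∑ i, area.real (cell x i) * (u i - c) ^ 2 ≤
      C₁ * (192 / volume.real (Metric.ball (0 : E3) (1 / 8))) ^ 2 * (1536 * C₁) ^ 2 *
        (384 * C₁) * dirichlet x u := by
  have : Nonempty (Fin N) := ⟨⟨0, by omega⟩⟩
  set v := volume.real (Metric.ball (0 : E3) (1 / 8))
  have hv : 0 < v := volume_ball_pos
  -- Comparing with the index of least potential lets the potential at `i` absorb the one at `i₀`;
  -- hence `192 = 2 * 96`.
  obtain ⟨i₀, hi₀⟩ := Finite.exists_min (potential x u)
  refine ⟨u i₀, ?_⟩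
  have h2 : ∀ i, (u i - u i₀) ^ 2 ≤ (192 / v) ^ 2 * potential x u i ^ 2 := by
    intro i
    rw [← mul_pow, ← sq_abs]
    refine pow_le_pow_left₀ (abs_nonneg _) ?_ 2
    rw [div_mul_eq_mul_div, le_div_iff₀ hv, mul_comm]
    have := volume_mul_abs_sub_le hx hN hh u i i₀
    linarith [hi₀ i]
  calc ∑ i, area.real (cell x i) * (u i - u i₀) ^ 2
      ≤ ∑ i, C₁ * meshSize x ^ 2 * ((192 / v) ^ 2 * potential x u i ^ 2) :=
        Finset.sum_le_sum fun i _ =>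
          mul_le_mul (hA.cell_upper i) (h2 i) (sq_nonneg _) (by positivity)
    _ = C₁ * meshSize x ^ 2 * (192 / v) ^ 2 * ∑ i, potential x u i ^ 2 := by
        rw [Finset.mul_sum]; exact Finset.sum_congr rfl fun i _ => by ring
    -- The `h²` from the cell areas cancels the `1 / h²` from Schur's test.
    _ ≤ C₁ * meshSize x ^ 2 * (192 / v) ^ 2 *
        ((1536 * C₁ / meshSize x) ^ 2 * (384 * C₁ * dirichlet x u)) :=
        mul_le_mul_of_nonneg_left (sum_potential_sq_le hC₁ hA hh h1 u) (by positivity)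
    _ = _ := by
        field_simp

end Grid

/-! ### Finite element functions and the energy estimate -/

section Grid

variable {N : ℕ} {x : Fin N → S2} {C₀ C₁ : ℝ}

/-- A lifted finite element function takes values between its values at vertices. -/
lemma exists_vertex_bounds {T : Finset (Finset (Fin N))} (hT : IsDelaunay x T) {u : S2 → ℝ}
    (hu : LiftedP1 x T u) (y : S2) : ∃ i j, u (x i) ≤ u y ∧ u y ≤ u (x j) := by
  obtain ⟨-, w, ⟨-, hw⟩, huw⟩ := hu
  obtain ⟨t, ht, r, hr, hry⟩ := hT.cover y
  obtain ⟨A, hA⟩ := hw t ht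
  have htne : t.Nonempty := Finset.card_pos.1 (by rw [hT.card_eq t ht]; norm_num)
  have huA : ∀ z ∈ planarSimplex x t, ∀ y : S2, (y : E3) = ‖z‖⁻¹ • z → u y = A z := by
    intro z hz y hy
    rw [huw z (mem_iUnion₂.2 ⟨t, ht, hz⟩) y hy]
    exact hA hz
  have hy : u y = A (r • (y : E3)) := by
    refine huA _ hry y ?_
    rw [norm_smul, norm_S2, mul_one, Real.norm_eq_abs, abs_of_pos hr, smul_smul,
      inv_mul_cancel₀ hr.ne', one_smul]
  have hv : ∀ k ∈ t, u (x k) = A (x k) := by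
    intro k hk
    refine huA _ (subset_convexHull ℝ _ ⟨k, hk, rfl⟩) _ ?_
    rw [norm_S2, inv_one, one_smul]
  obtain ⟨i, hi, hmin⟩ := t.exists_min_image (fun k => u (x k)) htne
  obtain ⟨j, hj, hmax⟩ := t.exists_max_image (fun k => u (x k)) htne
  have hlow : planarSimplex x t ⊆ A ⁻¹' Ici (u (x i)) := by
    refine convexHull_min ?_ ((convex_Ici _).affine_preimage A)
    rintro _ ⟨k, hk, rfl⟩
    exact (hmin k hk).trans (hv k hk).le
  have hupp : planarSimplex x t ⊆ A ⁻¹' Iic (u (x j)) := by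
    refine convexHull_min ?_ ((convex_Iic _).affine_preimage A)
    rintro _ ⟨k, hk, rfl⟩
    exact (hv k hk).ge.trans (hmax k hk)
  exact ⟨i, j, by rw [hy]; exact hlow hry, by rw [hy]; exact hupp hry⟩

/-- A zero-averaged lifted finite element function is bounded by an oscillation of its vertex
values. -/
lemma exists_abs_le_abs_sub [Nonempty (Fin N)] {T : Finset (Finset (Fin N))} (hT : IsDelaunay x T)
    {u : S2 → ℝ} (hu : u ∈ trialSpace x T) :
    ∃ i j, ∀ y, |u y| ≤ |u (x i) - u (x j)| := by
  obtain ⟨i, hi⟩ := Finite.exists_min fun k => u (x k)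
  obtain ⟨j, hj⟩ := Finite.exists_max fun k => u (x k)
  have hlow : ∀ y, u (x i) ≤ u y := fun y => by
    obtain ⟨k, -, hk, -⟩ := exists_vertex_bounds hT hu.1 y
    exact (hi k).trans hk
  have hupp : ∀ y, u y ≤ u (x j) := fun y => by
    obtain ⟨-, k, -, hk⟩ := exists_vertex_bounds hT hu.1 y
    exact hk.trans (hj k)
  have hint : Integrable u area := hu.1.1.integrable_of_hasCompactSupport
    (HasCompactSupport.of_compactSpace u)
  have hpos := area_real_univ_pos
  have h1 : area.real univ * u (x i) ≤ 0 := by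
    have := integral_mono (μ := area) (integrable_const (u (x i))) hint hlow
    rwa [hu.2, integral_const, smul_eq_mul] at this
  have h2 : 0 ≤ area.real univ * u (x j) := by
    have := integral_mono (μ := area) hint (integrable_const (u (x j))) hupp
    rwa [hu.2, integral_const, smul_eq_mul] at this
  -- Zero mean places `0` between the extreme vertex values.
  have h3 : u (x i) ≤ 0 := by by_contra h; push Not at h; nlinarith
  have h4 : 0 ≤ u (x j) := by by_contra h; push Not at h; nlinarith
  refine ⟨j, i, fun y => ?_⟩
  rw [abs_of_nonneg (by linarith : 0 ≤ u (x j) - u (x i)), abs_le]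
  constructor <;> linarith [hlow y, hupp y]

lemma sum_mul_indicator_cell (a : Fin N → ℝ) {i : Fin N} {y : S2} (hy : y ∈ cell x i) :
    ∑ k, a k * (cell x k).indicator (fun _ => (1 : ℝ)) y = a i := by
  rw [Finset.sum_eq_single i]
  · rw [indicator_of_mem hy, mul_one]
  · intro k _ hk
    rw [indicator_of_notMem fun h => Set.disjoint_left.1 (cell_disjoint hk) h hy, mul_zero]
  · exact fun h => absurd (Finset.mem_univ _) h

/-- The flux form controls the discrete Dirichlet energy. -/
lemma dirichlet_le_fluxForm (hx : Function.Injective x) (hC₀ : 0 < C₀)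
    (hA : AlmostUniform x C₀ C₁) (u : S2 → ℝ) :
    dirichlet x (fun i => u (x i)) ≤ 4 * C₀ * fluxForm x u u := by
  classical
  let w : Fin N → Fin N → ℝ := fun i j =>
    if j ∈ nbrs x i then len (edge x i j) / ‖(x j : E3) - x i‖ else 0
  have hw : ∀ i j, w i j = w j i := by
    intro i j
    simp only [w]
    rw [edge_comm, norm_sub_rev]
    exact if_congr mem_nbrs_comm rfl rfl
  have hsum : ∀ (i : Fin N) (g : Fin N → ℝ),
      ∑ j ∈ nbrs x i, g j = ∑ j, if j ∈ nbrs x i then g j else 0 := by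
    intro i g
    rw [Finset.sum_ite_mem, Finset.univ_inter]
  have h1 : fluxForm x u u = ∑ i, ∑ j, w i j * (u (x i) * (u (x i) - u (x j))) := by
    refine Finset.sum_congr rfl fun i _ => ?_
    rw [hsum, Finset.mul_sum]
    refine Finset.sum_congr rfl fun j _ => ?_
    simp only [w, flux]
    split_ifs
    · ring
    · ring
  have h2 : fluxForm x u u = ∑ i, ∑ j, w i j * (u (x j) * (u (x j) - u (x i))) := by
    rw [h1, Finset.sum_comm]
    exact Finset.sum_congr rfl fun i _ => Finset.sum_congr rfl fun j _ => by rw [hw]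
  -- Summation by parts, from the symmetry of the weights.
  have h3 : 2 * fluxForm x u u = ∑ i, ∑ j, w i j * (u (x i) - u (x j)) ^ 2 := by
    rw [two_mul]
    nth_rewrite 1 [h1]
    rw [h2, ← Finset.sum_add_distrib]
    refine Finset.sum_congr rfl fun i _ => ?_
    rw [← Finset.sum_add_distrib]
    exact Finset.sum_congr rfl fun j _ => by ring
  have h4 : dirichlet x (fun i => u (x i)) ≤ 2 * C₀ * ∑ i, ∑ j, w i j * (u (x i) - u (x j)) ^ 2 := by
    rw [dirichlet, Finset.mul_sum]
    refine Finset.sum_le_sum fun i _ => ?_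
    rw [hsum, Finset.mul_sum]
    refine Finset.sum_le_sum fun j _ => ?_
    simp only [w]
    split_ifs with hj
    · have hd : 0 < ‖(x j : E3) - x i‖ :=
        norm_pos_iff.2 (sub_ne_zero.2 fun e => (mem_nbrs.1 hj).1 (hx (Subtype.ext e)))
      have hl := hA.edge_lower i j hj
      rw [div_mul_eq_mul_div, one_mul, div_le_iff₀ hC₀] at hl
      -- The edge is at least `h / C₀` long, and neighbouring generators are at most `2 * h` apart.
      have hwt : 1 ≤ 2 * C₀ * (len (edge x i j) / ‖(x j : E3) - x i‖) := by
        rw [← mul_div_assoc, le_div_iff₀ hd]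
        linarith [norm_sub_le_of_mem_nbrs hj]
      rw [← mul_assoc]
      exact le_mul_of_one_le_left (sq_nonneg _) hwt
    · simp
  rw [← h3] at h4
  linarith

/-- The stability of the finite volume solution in the discrete Dirichlet energy, deduced from a
Poincaré inequality with constant `P`. -/
lemma dirichlet_le_integral_sq (hx : Function.Injective x) (hC₀ : 0 < C₀)
    (hA : AlmostUniform x C₀ C₁) [Nonempty (Fin N)]
    {T : Finset (Finset (Fin N))} {f u : S2 → ℝ} (hf : MemLp f 2 area) (hf0 : ∫ y, f y ∂area = 0)
    (hu : IsFVSolution x T f u) {P c : ℝ} (hP : 0 < P)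
    (hc : ∑ i, area.real (cell x i) * (u (x i) - c) ^ 2 ≤ P * dirichlet x fun i => u (x i)) :
    dirichlet x (fun i => u (x i)) ≤ 16 * C₀ ^ 2 * P * ∫ y, f y ^ 2 ∂area := by
  set D := dirichlet x fun i => u (x i)
  have hD := dirichlet_le_fluxForm hx hC₀ hA u
  rw [hu.2 u hu.1] at hD
  have hcell := ae_exists_mem_cell hx
  have hind : ∀ k, Integrable ((cell x k).indicator fun _ => (1 : ℝ)) area := fun k =>
    (integrable_const _).indicator (measurableSet_cell k)
  have hf2 : Integrable (fun y => f y ^ 2) area := hf.integrable_sq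
  have hf1 : Integrable f area := hf.integrable one_le_two
  have hg2 : Integrable (fun y => ∑ k, (u (x k) - c) ^ 2 *
      (cell x k).indicator (fun _ => (1 : ℝ)) y) area :=
    integrable_finsetSum _ fun k _ => (hind k).const_mul _
  have hg2v : ∫ y, ∑ k, (u (x k) - c) ^ 2 * (cell x k).indicator (fun _ => (1 : ℝ)) y ∂area =
      ∑ i, area.real (cell x i) * (u (x i) - c) ^ 2 := by
    rw [integral_finsetSum _ fun k _ => (hind k).const_mul _]
    refine Finset.sum_congr rfl fun k _ => ?_
    rw [integral_const_mul, integral_indicator_const _ (measurableSet_cell k), smul_eq_mul]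
    ring
  have hfT : Integrable (fun y => f y * transfer x u y) area := by
    have : (fun y => f y * transfer x u y) =
        fun y => ∑ k, u (x k) * (cell x k).indicator f y := by
      funext y
      rw [transfer, Finset.mul_sum]
      refine Finset.sum_congr rfl fun k _ => ?_
      by_cases hy : y ∈ cell x k
      · rw [indicator_of_mem hy, indicator_of_mem hy]; ring
      · rw [indicator_of_notMem hy, indicator_of_notMem hy]; ring
    rw [this]
    exact integrable_finsetSum _ fun k _ => (hf1.indicator (measurableSet_cell k)).const_mul _
  -- This Young weight makes the Poincaré term at most `D / (4 * C₀)`, one half of the left side, so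
  -- it can be absorbed. Subtracting `c` costs nothing since `f` has zero mean.
  set s := 4 * C₀ * P with hs
  have hs0 : 0 < s := by positivity
  have hle : ∫ y, 2 * (f y * transfer x u y - f y * c) ∂area ≤
      ∫ y, (s * f y ^ 2 + s⁻¹ * ∑ k, (u (x k) - c) ^ 2 *
        (cell x k).indicator (fun _ => (1 : ℝ)) y) ∂area := by
    refine integral_mono_ae ((hfT.sub (hf1.mul_const c)).const_mul 2)
      ((hf2.const_mul s).add (hg2.const_mul s⁻¹)) ?_
    filter_upwards [hcell] with y ⟨i, hi⟩
    rw [transfer, sum_mul_indicator_cell _ hi, sum_mul_indicator_cell _ hi, ← mul_sub]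
    have h1 : 0 ≤ s⁻¹ * (s * f y - (u (x i) - c)) ^ 2 := by positivity
    have h2 : s⁻¹ * (s * f y - (u (x i) - c)) ^ 2 =
        s * f y ^ 2 + s⁻¹ * (u (x i) - c) ^ 2 - 2 * (f y * (u (x i) - c)) := by
      field_simp
      ring
    linarith
  rw [integral_const_mul, integral_sub hfT (hf1.mul_const c), integral_mul_const, hf0, zero_mul,
    sub_zero, integral_add (hf2.const_mul s) (hg2.const_mul s⁻¹), integral_const_mul,
    integral_const_mul, hg2v] at hle
  set F := ∫ y, f y ^ 2 ∂area
  have h3 : s⁻¹ * ∑ i, area.real (cell x i) * (u (x i) - c) ^ 2 ≤ D / (4 * C₀) := by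
    refine (mul_le_mul_of_nonneg_left hc (inv_nonneg.2 hs0.le)).trans (le_of_eq ?_)
    rw [hs]
    field_simp
  have h4 : D / (4 * C₀) ≤ ∫ y, f y * transfer x u y ∂area := by
    rw [div_le_iff₀ (by positivity)]
    linarith
  have h5 : D / (4 * C₀) ≤ s * F := by linarith
  rw [div_le_iff₀ (by positivity)] at h5
  refine h5.trans (le_of_eq ?_)
  rw [hs]
  ring

end Grid

end SphereFV

/-! ### The maximum norm bound -/

theorem mainTheorem7 (C₀ C₁ h₀ : ℝ) (hC₀ : 0 < C₀) (hC₁ : 0 < C₁) (hh₀ : h₀ < 1) :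
    ∃ C : ℝ, 0 < C ∧
      ∀ (N : ℕ) (x : Fin N → S2) (T : Finset (Finset (Fin N))),
        Function.Injective x → IsDelaunay x T → AlmostUniform x C₀ C₁ → meshSize x ≤ h₀ →
        ∀ f : S2 → ℝ, MemLp f 2 area → ∫ y, f y ∂area = 0 →
        ∀ u : S2 → ℝ, IsFVSolution x T f u →
          eLpNorm u ⊤ area ≤
            ENNReal.ofReal (C * |Real.log (meshSize x)| ^ (1 / 2 : ℝ)) * eLpNorm f 2 area := by
  set v := volume.real (Metric.ball (0 : E3) (1 / 8))
  have hv : 0 < v := volume_ball_pos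
  -- The maximum keeps the argument of the logarithm positive even if `h₀ ≤ 0`.
  set h₁ := max h₀ (1 / 2)
  have hh₁ : h₁ < 1 := max_lt hh₀ (by norm_num)
  have hh₁0 : 0 < h₁ := lt_of_lt_of_le (by norm_num) (le_max_right _ _)
  set L := -Real.log h₁
  have hL : 0 < L := neg_pos.2 (Real.log_neg hh₁0 hh₁)
  set P := C₁ * (192 / v) ^ 2 * (1536 * C₁) ^ 2 * (384 * C₁)
  have hP : 0 < P := by positivity
  set K := (192 / v) ^ 2 * ((384 * C₁) ^ 2 * (3 / L + 2)) * (16 * C₀ ^ 2 * P)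
  have hK : 0 < K := by positivity
  refine ⟨Real.sqrt K, Real.sqrt_pos.2 hK, ?_⟩
  intro N x T hx hT hA hmesh f hf hf0 u hu
  have hN := three_le_card hT
  have : Nonempty (Fin N) := ⟨⟨0, by omega⟩⟩
  have hh := meshSize_pos hx hA
  have hh1 : meshSize x ≤ h₁ := hmesh.trans (le_max_left _ _)
  have hlt : meshSize x < 1 := hh1.trans_lt hh₁
  set ℓ := |Real.log (meshSize x)| with hℓ
  have hLℓ : L ≤ ℓ := by
    rw [hℓ, abs_of_neg (Real.log_neg hh hlt)]
    exact neg_le_neg (Real.log_le_log hh hh1)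
  obtain ⟨c, hc⟩ := exists_sum_area_mul_sq_le hx hN hC₁ hA hh hlt fun i => u (x i)
  have hD := dirichlet_le_integral_sq hx hC₀ hA hf hf0 hu hP hc
  set D := dirichlet x fun i => u (x i)
  set F := ∫ y, f y ^ 2 ∂area with hF
  have hF0 : 0 ≤ F := integral_nonneg fun y => sq_nonneg _
  -- Since `ℓ ≥ L > 0`, the additive constant is absorbed into the logarithm; this makes the
  -- constant depend on `h₀`.
  have hlog : 3 + 2 * ℓ ≤ (3 / L + 2) * ℓ := by
    have : 3 ≤ 3 / L * ℓ := by
      rw [div_mul_eq_mul_div, le_div_iff₀ hL]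
      linarith
    linarith
  have hpot : ∀ i, potential x (fun i => u (x i)) i ^ 2 ≤
      (384 * C₁) ^ 2 * (3 / L + 2) * ℓ * (16 * C₀ ^ 2 * P * F) := by
    intro i
    refine (potential_sq_le hC₁ hA hh hlt _ i).trans ?_
    calc 384 * C₁ * D * (384 * C₁ * (3 + 2 * ℓ))
        ≤ 384 * C₁ * (16 * C₀ ^ 2 * P * F) * (384 * C₁ * ((3 / L + 2) * ℓ)) := by gcongr
      _ = _ := by ring
  obtain ⟨i, j, hij⟩ := exists_abs_le_abs_sub hT hu.1
  have hosc : |u (x i) - u (x j)| ≤ Real.sqrt (K * ℓ * F) := by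
    refine Real.le_sqrt_of_sq_le ?_
    have h1 := volume_mul_abs_sub_le hx hN hh (fun i => u (x i)) i j
    have h2 : |u (x i) - u (x j)| ≤ 96 / v * (potential x (fun i => u (x i)) i +
        potential x (fun i => u (x i)) j) := by
      rw [div_mul_eq_mul_div, le_div_iff₀ hv, mul_comm]
      exact h1
    refine (pow_le_pow_left₀ (abs_nonneg _) h2 2).trans ?_
    rw [mul_pow]
    calc (96 / v) ^ 2 * (potential x (fun i => u (x i)) i + potential x (fun i => u (x i)) j) ^ 2
        ≤ (96 / v) ^ 2 * (4 * ((384 * C₁) ^ 2 * (3 / L + 2) * ℓ * (16 * C₀ ^ 2 * P * F))) := by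
          refine mul_le_mul_of_nonneg_left ?_ (sq_nonneg _)
          refine add_sq_le.trans ?_
          linarith [hpot i, hpot j]
      _ = K * ℓ * F := by simp only [K]; ring
  have hsqrt : Real.sqrt (K * ℓ * F) = Real.sqrt K * ℓ ^ (1 / 2 : ℝ) * Real.sqrt F := by
    rw [Real.sqrt_mul (by positivity), Real.sqrt_mul hK.le, Real.sqrt_eq_rpow ℓ]
  have hfn : eLpNorm f 2 area = ENNReal.ofReal (Real.sqrt F) := by
    rw [hf.eLpNorm_eq_integral_rpow_norm (by norm_num) (by norm_num), Real.sqrt_eq_rpow, hF]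
    simp
  rw [hfn, ← ENNReal.ofReal_mul (by positivity), ← hsqrt, eLpNorm_exponent_top]
  refine eLpNormEssSup_le_of_ae_bound (Filter.Eventually.of_forall fun y => ?_)
  exact (hij y).trans hosc
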